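/- Let $n\ge 2$, let $(M^n,g)$ be a smooth Riemannian manifold, $N:M\to(0,\infty)$ a smooth function, and consider the static spacetime $(\mathbb R\times M,\ \mathfrak g=-N^2dt^2+g)$; no field equations are assumed. All hypersurfaces are smooth and embedded. A timelike hypersurface $P\subset\mathbb R\times M$ is a \emph{photon surface} if every null geodesic that is initially tangent to $P$ remains in $P$ and tangent to $P$ as long as it exists (if $P$ is not closed, as long as it does not meet the edge $\overline P\setminus P$). A \emph{photon sphere} is a photon surface of the form $P=\mathbb R\times\Sigma$, with $\Sigma\subset M$ a hypersurface, along which $N$ is constant; in an electrostatic spacetime, i.e. if in addition a smooth time-independent potential $\Psi:M\to\mathbb R$ is given, one also requires $\Psi$ and $|d\Psi|_{\mathfrak g}$ to be constant along $P$. It is \emph{non-degenerate} if $dN\ne0$ at every point of $P$. The \emph{canonical time slices} of $P$ are $\Sigma(t)=P\cap(\{t\}\times M)$, viewed as hypersurfaces of $(M,g)$. Let $\nu$ denote a unit normal of $\Sigma(t)$ in $M$, $h(X,Y)=g(\nabla_X\nu,Y)$ its second fundamental form and $H=\operatorname{tr}h$ its mean curvature; let $\eta$ and $\mathfrak H$ denote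 a unit normal of $P$ in the spacetime and the mean curvature of $P$ with respect to $\eta$. (a) Let $P$ be a non-degenerate photon sphere. Then on every canonical time slice of $P$ $$N H=(n-1)\,\nu(N).$$ In particular, $\nu(N)H>0$ on every canonical time slice and $\eta(N)\mathfrak H>0$ along $P$. Moreover $H$ is constant along any, or every, canonical time slice if and only if $\nu(N)$ is constant along any, or every, canonical time slice, and $\mathfrak H$ is constant along $P$ if and only if $\eta(N)$ is constant along $P$. (b) Conversely, these conditions characterize photon spheres: for a hypersurface $\Sigma\subset M$, the product $\mathbb R\times\Sigma$ is a non-degenerate photon sphere of the static spacetime if and only if $\Sigma$ is totally umbilic in $(M,g)$, $N$ is constant along $\Sigma$, $dN\neq0$ at every point of $\Sigma$, and $NH=(n-1)\nu(N)$ on $\Sigma$. (c) For a smooth potential $\Psi:M\to\mathbb R$, the product $\mathbb R\times\Sigma$ is a non-degenerate photon sphere of the electrostatic spacetime $(\mathbb R\times M,\mathfrak g,\Psi)$ if and only if $\Sigma$ is totally umbilic in $(M,g)$, $N$, $\Psi$ and $|d\Psi|_g$ are constant along $\Sigma$, $dN\neq0$ at every point of $\Sigma$, and $NH=(n-1)\nu(N)$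 on $\Sigma$. -/

import Mathlib

open Set Filter Topology Bundle
open scoped Manifold ContDiff

noncomputable section

namespace PhotonSphere

/-! ### Metrics, geodesics and hypersurfaces on a manifold without boundary -/

section General

variable {V : Type*} [NormedAddCommGroup V] [NormedSpace ℝ V]
  {H : Type*} [TopologicalSpace H] {J : ModelWithCorners ℝ V H}
  {X : Type*} [TopologicalSpace X] [ChartedSpace H X] [IsManifold J 1 X]

/-- A field of (bilinear) forms on the tangent spaces of `X`; the definitions below are applied to
a Riemannian metric and to the Lorentzian metric of a static spacetime. -/
abbrev MetricField (J : ModelWithCorners ℝ V H) (X : Type*) [TopologicalSpace X]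
    [ChartedSpace H X] : Type _ :=
  ∀ p : X, TangentSpace J p → TangentSpace J p → ℝ

/-- The tangent vector at `x` with components `u` in the coordinates of the chart around `q`, i.e.
the image of `u` under the derivative of the inverse chart. -/
def ofCoord (q x : X) : V →L[ℝ] TangentSpace J x :=
  (trivializationAt V (TangentSpace J : X → Type _) q).symmL ℝ x

/-- The components of a tangent vector at `x` in the coordinates of the chart around `q`, i.e. its
image under the derivative of the chart. -/
def toCoord (q x : X) : TangentSpace J x →L[ℝ] V :=
  (trivializationAt V (TangentSpace J : X → Type _) q).continuousLinearMapAt ℝ x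

/-- The components `G_y(u, v)` of a metric `G` in the coordinates `y` of the chart around `q`. -/
def coordMetric (G : MetricField J X) (q : X) (y u v : V) : ℝ :=
  G ((extChartAt J q).symm y) (ofCoord q _ u) (ofCoord q _ v)

/-- The Christoffel symbols of the first kind in the coordinates of the chart around `q`:
`(∂_u G(v, w) + ∂_v G(u, w) - ∂_w G(u, v)) / 2`, which is `G(∇_u v, w)` for the Levi-Civita
connection `∇` and coordinate vector fields `u, v, w`. -/
def christoffel (G : MetricField J X) (q : X) (y u v w : V) : ℝ :=
  (fderiv ℝ (fun z => coordMetric G q z v w) y u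
    + fderiv ℝ (fun z => coordMetric G q z u w) y v
    - fderiv ℝ (fun z => coordMetric G q z u v) y w) / 2

/-- The number `G(∇_u Y, w)` at `p`, where `∇` is the Levi-Civita connection of `G`, for a vector
field `Y` and tangent vectors `u, w` at `p`, computed in the chart around `p`. -/
def covDerivLowered (G : MetricField J X) (Y : ∀ x : X, TangentSpace J x) (p : X)
    (u w : TangentSpace J p) : ℝ :=
  let φ := extChartAt J p
  let coordY : V → V := fun z => toCoord p (φ.symm z) (Y (φ.symm z))
  let u' : V := toCoord p p u
  let w' : V := toCoord p p w
  coordMetric G p (φ p) (fderiv ℝ coordY (φ p) u') w'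
    + christoffel G p (φ p) u' (coordY (φ p)) w'

/-- The velocity of a curve. -/
def velocity (J : ModelWithCorners ℝ V H) (γ : ℝ → X) (s : ℝ) : TangentSpace J (γ s) :=
  mfderiv 𝓘(ℝ, ℝ) J γ s ((NormedSpace.fromTangentSpace s).symm (1 : ℝ))

/-- `γ` is an (affinely parametrized) geodesic of the nondegenerate metric `G` on the open set `T`
of parameters: around each parameter, the geodesic equation `c'' + Γ(c', c') = 0` (with the index
lowered by `G`) holds for the expression `c` of `γ` in some chart. -/
def IsGeodesicOn (G : MetricField J X) (γ : ℝ → X) (T : Set ℝ) : Prop :=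
  ContMDiffOn 𝓘(ℝ, ℝ) J 2 γ T ∧
  ∀ s₀ ∈ T, ∃ q : X, γ s₀ ∈ (chartAt H q).source ∧
    let c : ℝ → V := fun s => extChartAt J q (γ s)
    ∀ᶠ s in 𝓝 s₀, ∀ w : V,
      coordMetric G q (c s) (deriv (deriv c) s) w
        + christoffel G q (c s) (deriv c s) (deriv c s) w = 0

/-- A null geodesic: its velocity is a null vector (nonzero, of length zero) everywhere. -/
def IsNullGeodesicOn (G : MetricField J X) (γ : ℝ → X) (T : Set ℝ) : Prop :=
  IsGeodesicOn G γ T ∧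
  ∀ s ∈ T, velocity J γ s ≠ 0 ∧ G (γ s) (velocity J γ s) (velocity J γ s) = 0

/-- `S` is a smooth embedded hypersurface: locally a regular level set. -/
def IsHypersurface (J : ModelWithCorners ℝ V H) (S : Set X) : Prop :=
  ∀ p ∈ S, ∃ U : Set X, IsOpen U ∧ p ∈ U ∧ ∃ f : X → ℝ, ContMDiffOn J 𝓘(ℝ, ℝ) ∞ f U ∧
    (∀ x ∈ U, mvfderiv J f x ≠ 0) ∧ S ∩ U = {x ∈ U | f x = 0}

/-- The tangent space at `p` of a hypersurface `S`: the tangent vectors that annihilate every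
smooth function which is defined near `p` and vanishes on `S`. -/
def tangentSpaceOf (J : ModelWithCorners ℝ V H) (S : Set X) (p : X) :
    Submodule ℝ (TangentSpace J p) where
  carrier := {v | ∀ U : Set X, IsOpen U → p ∈ U → ∀ f : X → ℝ, ContMDiffOn J 𝓘(ℝ, ℝ) ∞ f U →
    (∀ x ∈ S ∩ U, f x = 0) → mvfderiv J f p v = 0}
  add_mem' := by
    intro a b ha hb U hU hp f hf h0
    rw [map_add, ha U hU hp f hf h0, hb U hU hp f hf h0]
    exact add_zero _
  zero_mem' := by
    intro U hU hp f hf h0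
    exact map_zero _
  smul_mem' := by
    intro c a ha U hU hp f hf h0
    rw [map_smul, ha U hU hp f hf h0]
    exact smul_zero _

/-- `ν` is a (spacelike) unit normal vector to `S` at `p`. -/
def IsUnitNormal (G : MetricField J X) (S : Set X) (p : X) (ν : TangentSpace J p) : Prop :=
  (∀ w ∈ tangentSpaceOf J S p, G p ν w = 0) ∧ G p ν ν = 1

/-- `Y` is a vector field, smooth near `p`, tangent to `S` along `S` near `p`, with value `w` at
`p`. -/
def IsTangentExtension (S : Set X) (p : X) (w : TangentSpace J p)
    (Y : ∀ x : X, TangentSpace J x) : Prop :=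
  (∀ᶠ x₀ in 𝓝 p, ContMDiffAt J J.tangent ∞ (fun x => (⟨x, Y x⟩ : TangentBundle J X)) x₀) ∧
  (∀ᶠ x in 𝓝 p, x ∈ S → Y x ∈ tangentSpaceOf J S x) ∧ Y p = w

/-- The second fundamental form `h(u, w) = -G(∇_u Y, ν) = G(∇_u ν, w)` of the hypersurface `S` at
`p` with respect to the unit normal `ν`, for vectors `u, w` tangent to `S`; here `Y` is any
extension of `w` to a vector field tangent to `S` (the value does not depend on it). -/
def secondFundamentalForm (G : MetricField J X) (S : Set X) (p : X) (ν : TangentSpace J p)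
    (u w : TangentSpace J p) : ℝ :=
  - covDerivLowered G (Classical.epsilon (IsTangentExtension S p w)) p u ν

/-- The trace `B^{ij} h_{ij}` of a bilinear form `h` with respect to a nondegenerate symmetric
bilinear form `B` (the value does not depend on the basis). -/
def metricTrace {W : Type*} [AddCommGroup W] [Module ℝ W] [FiniteDimensional ℝ W]
    (B h : W → W → ℝ) : ℝ :=
  let b := Module.finBasis ℝ W
  ∑ i, ∑ j, (Matrix.of fun k l => B (b k) (b l))⁻¹ i j * h (b i) (b j)

instance instFiniteDimensionalTangentSpace [FiniteDimensional ℝ V] (p : X) :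
    FiniteDimensional ℝ (TangentSpace J p) :=
  inferInstanceAs (FiniteDimensional ℝ V)

/-- The mean curvature of `S` at `p` with respect to the unit normal `ν`: the trace of the second
fundamental form with respect to the induced metric. -/
def meanCurvature [FiniteDimensional ℝ V] (G : MetricField J X) (S : Set X)
    (p : X) (ν : TangentSpace J p) : ℝ :=
  metricTrace (W := tangentSpaceOf J S p) (fun u w => G p u w)
    (fun u w => secondFundamentalForm G S p ν u w)

/-- `S` is totally umbilic: its second fundamental form is pure trace. -/
def IsTotallyUmbilic (G : MetricField J X) (S : Set X) : Prop :=
  ∀ p ∈ S, ∀ ν : TangentSpace J p, IsUnitNormal G S p ν →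
    ∃ a : ℝ, ∀ u ∈ tangentSpaceOf J S p, ∀ w ∈ tangentSpaceOf J S p,
      secondFundamentalForm G S p ν u w = a * G p u w

/-- The length `|df|` of the differential of `f` at `p`. -/
def differentialLength [FiniteDimensional ℝ V] (G : MetricField J X) (f : X → ℝ) (p : X) : ℝ :=
  Real.sqrt (metricTrace (W := TangentSpace J p) (fun u w => G p u w)
    (fun u w => mvfderiv J f p u * mvfderiv J f p w))

/-- A timelike hypersurface of a Lorentzian manifold: each tangent space contains a timelike vector
(for a hyperplane this says that the induced metric is Lorentzian). -/
def IsTimelikeHypersurface (G : MetricField J X) (P : Set X) : Prop :=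
  IsHypersurface J P ∧ ∀ p ∈ P, ∃ v ∈ tangentSpaceOf J P p, G p v v < 0

/-- A photon surface: a timelike hypersurface `P` such that every null geodesic that is tangent to
`P` at one parameter remains in `P` and tangent to `P` as long as it exists. If `P` is not a closed
subset, a geodesic may run out of `P` through the edge `closure P \ P`, so then only geodesics
that do not meet the edge are considered. -/
def IsPhotonSurface (G : MetricField J X) (P : Set X) : Prop :=
  IsTimelikeHypersurface G P ∧
  ∀ (γ : ℝ → X) (T : Set ℝ), IsOpen T → T.OrdConnected → IsNullGeodesicOn G γ T →
    (∀ s ∈ T, γ s ∉ closure P \ P) →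
    ∀ s₀ ∈ T, γ s₀ ∈ P → velocity J γ s₀ ∈ tangentSpaceOf J P (γ s₀) →
      ∀ s ∈ T, γ s ∈ P ∧ velocity J γ s ∈ tangentSpaceOf J P (γ s)

end General

/-- `f` is constant on `S`. -/
def IsConstOn {A : Type*} (f : A → ℝ) (S : Set A) : Prop :=
  ∃ c : ℝ, ∀ x ∈ S, f x = c

/-! ### Static spacetimes `(ℝ × M, -N² dt² + g)` and photon spheres -/

section Static

variable {n : ℕ} {M : Type*} [TopologicalSpace M] [ChartedSpace (EuclideanSpace ℝ (Fin n)) M]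
  [IsManifold (𝓡 n) ∞ M]

/-- The metric field of a Riemannian metric. -/
def metricField
    (g : ContMDiffRiemannianMetric (𝓡 n) ∞ (EuclideanSpace ℝ (Fin n))
      (fun x : M => TangentSpace (𝓡 n) x)) : MetricField (𝓡 n) M :=
  fun x u v => g.inner x u v

/-- The static spacetime metric `-N² dt² + g` on `ℝ × M`. -/
def staticMetric (g : MetricField (𝓡 n) M) (N : M → ℝ) :
    MetricField (𝓘(ℝ, ℝ).prod (𝓡 n)) (ℝ × M) := fun p u v =>
  let dt : TangentSpace (𝓘(ℝ, ℝ).prod (𝓡 n)) p → ℝ :=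
    mvfderiv (𝓘(ℝ, ℝ).prod (𝓡 n)) (Prod.fst : ℝ × M → ℝ) p
  let proj : TangentSpace (𝓘(ℝ, ℝ).prod (𝓡 n)) p → TangentSpace (𝓡 n) p.2 :=
    mfderiv (𝓘(ℝ, ℝ).prod (𝓡 n)) (𝓡 n) (Prod.snd : ℝ × M → M) p
  g p.2 (proj u) (proj v) - N p.2 ^ 2 * (dt u * dt v)

/-- A function on `M`, viewed as a time-independent function on `ℝ × M`. -/
def timeIndependent (f : M → ℝ) : ℝ × M → ℝ := fun p => f p.2

/-- The canonical time slice of `P` at time `t`, viewed as a subset of `M ≅ {t} × M`. -/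
def timeSlice (P : Set (ℝ × M)) (t : ℝ) : Set M := {x | (t, x) ∈ P}

/-- A photon sphere in the static spacetime `(ℝ × M, -N² dt² + g)`. -/
def IsPhotonSphere (g : MetricField (𝓡 n) M) (N : M → ℝ) (P : Set (ℝ × M)) : Prop :=
  IsPhotonSurface (staticMetric g N) P ∧
  (∃ S : Set M, IsHypersurface (𝓡 n) S ∧ P = univ ×ˢ S) ∧
  IsConstOn (timeIndependent N) P

/-- A photon sphere in the electrostatic spacetime `(ℝ × M, -N² dt² + g, Ψ)`. -/
def IsElectrostaticPhotonSphere (g : MetricField (𝓡 n) M) (N Ψ : M → ℝ) (P : Set (ℝ × M)) :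
    Prop :=
  IsPhotonSphere g N P ∧ IsConstOn (timeIndependent Ψ) P ∧
  IsConstOn (differentialLength (staticMetric g N) (timeIndependent Ψ)) P

/-- Non-degeneracy: `dN ≠ 0` at every point of `P`. -/
def IsNondegenerate (n : ℕ) {M : Type*} [TopologicalSpace M]
    [ChartedSpace (EuclideanSpace ℝ (Fin n)) M] (N : M → ℝ) (P : Set (ℝ × M)) : Prop :=
  ∀ p ∈ P, mvfderiv (𝓘(ℝ, ℝ).prod (𝓡 n)) (timeIndependent N) p ≠ 0

/-- The photon sphere constraint `N H = (n - 1) ν(N)` on a hypersurface `S` of `M`, for every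
(equivalently, either) choice of the unit normal `ν` at each point. -/
def PhotonSphereConstraint (g : MetricField (𝓡 n) M) (N : M → ℝ) (S : Set M) : Prop :=
  ∀ x ∈ S, ∀ ν : TangentSpace (𝓡 n) x, IsUnitNormal g S x ν →
    N x * meanCurvature g S x ν = ((n : ℝ) - 1) * mvfderiv (𝓡 n) N x ν

end Static

end PhotonSphere

end

open PhotonSphere

/-! Everything is expressed through the Hessian of a local defining function. Let `f` define a
hypersurface, with gradient `ξ`. Differentiating `df(Y) = 0` for a tangent field `Y` shows that the
second fundamental form with respect to `a • ξ` is `a` times the Hessian of `f` on tangent vectors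
(`secondFundamentalForm_eq`). Along a geodesic `c`, the second derivative of `f ∘ c` is the Hessian
on the velocity.

A timelike hypersurface with non-null gradient is therefore a photon surface exactly when this
Hessian vanishes on tangent null vectors. Necessity (`IsPhotonSurface.hessianAt_eq_zero`): start a
null geodesic with the given velocity; it stays in `P`, so its second derivative of `f` is zero.
Sufficiency (`isPhotonSurface_of_hessianAt_eq_zero`): the map `(y, Z) ↦ (f, df(Z), G(Z, Z))` is a
submersion at a tangent null `Z ≠ 0`, so the Hessian is bounded by a multiple of this map nearby. On
a null geodesic the third entry is zero, hence the pair `(f, df(c'))` satisfies a linear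
differential inequality and vanishes by Grönwall. A connectedness argument makes this global.

For `ℝ × S` in a static spacetime and time-independent `f`, the spacetime Hessian is `Hess_g f - N
ξ(N) dt²` (`hessianAt_timeIndependent`). Testing it on the null vectors `(|u| / N, u)` with `u`
tangent to `S`, and polarizing, gives `Hess_g f = (ξ(N) / N) g` on `S`. In this way the photon
surface condition is equivalent to umbilicity with the prescribed factor `ν(N) / N`. Tracing over
the `n - 1` directions of `S`, or the `n` directions of `ℝ × S`, gives `H = (n - 1) ν(N) / N` and `𝔥
= n η(N) / N`.

Constancy of `N` together with `dN ≠ 0` makes the normal derivative of `N` nonzero, which gives the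
signs. Constancy of `N` also makes the mean curvatures fixed nonzero multiples of the normal
derivatives. -/

noncomputable section

namespace PhotonSphere

/-! ### Calculus in a vector space: submersions, Grönwall, Hessians, geodesic equation. -/

section Calculus

set_option maxSynthPendingDepth 3

/-- A function that vanishes on the zero set of a submersion is locally bounded by a multiple of
the norm of the submersion. -/
theorem exists_abs_le_mul_norm_of_eq_zero {E F : Type*} [NormedAddCommGroup E] [NormedSpace ℝ E]
    [CompleteSpace E] [NormedAddCommGroup F] [NormedSpace ℝ F] [CompleteSpace F]
    {Φ : E → F} {Φ' : E →L[ℝ] F} {a : E} (hΦ : HasStrictFDerivAt Φ Φ' a) (hsurj : Φ'.range = ⊤)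
    (h0 : Φ a = 0) {K : E → ℝ} {K' : E →L[ℝ] ℝ} (hK : HasStrictFDerivAt K K' a)
    (hv : ∀ᶠ x in 𝓝 a, Φ x = 0 → K x = 0) :
    ∃ C : ℝ, ∀ᶠ x in 𝓝 a, |K x| ≤ C * ‖Φ x‖ := by
  let R := Φ'.nonlinearRightInverseOfSurjective hsurj
  have Rpos : 0 < R.nnnorm := Φ'.nonlinearRightInverseOfSurjective_nnnorm_pos hsurj
  have cpos : 0 < R.nnnorm⁻¹ / 2 := by positivity
  obtain ⟨s, hs, hsa⟩ := hΦ.approximates_deriv_on_nhds (Or.inr cpos)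
  obtain ⟨L, t, ht, hL⟩ := hK.exists_lipschitzOnWith
  obtain ⟨r, hr, hball⟩ := Metric.nhds_basis_ball.mem_iff.1
    (Filter.inter_mem (Filter.inter_mem hs ht) hv)
  set c : ℝ := 2 * (R.nnnorm : ℝ) with hc
  have hcpos : 0 < c := by positivity
  have hΦ0 : Tendsto (fun x => c * ‖Φ x‖) (𝓝 a) (𝓝 0) := by
    have := (hΦ.continuousAt.norm.tendsto.const_mul c)
    simpa [h0] using this
  refine ⟨L * c, ?_⟩
  filter_upwards [Metric.ball_mem_nhds a (half_pos hr), hΦ0.eventually_lt_const (half_pos hr)]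
    with x hx hx'
  have hsub : Metric.closedBall x (c * ‖Φ x‖) ⊆ Metric.ball a r := by
    intro z hz
    rw [Metric.mem_closedBall] at hz
    rw [Metric.mem_ball] at hx ⊢
    linarith [dist_triangle z x a]
  -- Quantitative surjectivity: the radius `2R‖Φ x‖` is chosen so that the image of the ball around
  -- `x` contains the ball of radius `‖Φ x‖` around `Φ x`, hence `0`. So `x` is within `2R‖Φ x‖` of
  -- a zero `z` of `Φ`, and the Lipschitz bound for `K` compares `K x` with `K z = 0`.
  have hsurjOn := hsa.surjOn_closedBall_of_nonlinearRightInverse R (b := x)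
    (ε := c * ‖Φ x‖) (by positivity) (fun z hz => (hball (hsub hz)).1.1)
  have hmem : (0 : F) ∈ Metric.closedBall (Φ x)
      (((R.nnnorm : ℝ)⁻¹ - ((R.nnnorm⁻¹ / 2 : NNReal) : ℝ)) * (c * ‖Φ x‖)) := by
    have : ((R.nnnorm : ℝ)⁻¹ - ((R.nnnorm⁻¹ / 2 : NNReal) : ℝ)) * (c * ‖Φ x‖) = ‖Φ x‖ := by
      have : (R.nnnorm : ℝ) ≠ 0 := by exact_mod_cast Rpos.ne'
      push_cast
      rw [hc]
      field_simp
      ring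
    rw [this, Metric.mem_closedBall, dist_zero_left]
  obtain ⟨z, hz, hz0⟩ := hsurjOn hmem
  have hKz : K z = 0 := (hball (hsub hz)).2 hz0
  have hxr : x ∈ Metric.ball a r := hsub (Metric.mem_closedBall_self (by positivity))
  have h1 := hL.dist_le_mul x (hball hxr).1.2 z (hball (hsub hz)).1.2
  rw [hKz, Real.dist_eq, sub_zero] at h1
  refine h1.trans ?_
  rw [mul_assoc, dist_comm]
  exact mul_le_mul_of_nonneg_left hz L.2

/-- A Grönwall uniqueness statement: a function whose derivative is bounded by a multiple of the
function and which vanishes at a point vanishes nearby. -/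
theorem eventually_eq_zero_of_norm_deriv_le {E : Type*} [NormedAddCommGroup E] [NormedSpace ℝ E]
    {f f' : ℝ → E} {K t₀ : ℝ} (hf : ∀ᶠ t in 𝓝 t₀, HasDerivAt f (f' t) t)
    (hK : ∀ᶠ t in 𝓝 t₀, ‖f' t‖ ≤ K * ‖f t‖) (h0 : f t₀ = 0) : ∀ᶠ t in 𝓝 t₀, f t = 0 := by
  classical
  -- The vector field is only needed on the two points `0` and `f t`: it is `f' t` at `f t` and zero
  -- elsewhere. The hypothesis says exactly that it is Lipschitz there, and both `f` and the zero
  -- function are solutions.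
  have key := ODE_solution_unique_of_eventually (t₀ := t₀) (K := K.toNNReal)
    (v := fun t x => if x = f t then f' t else 0) (s := fun t => {0, f t}) (f := f) (g := fun _ => 0)
    ?_ ?_ ?_ h0
  · exact key
  · filter_upwards [hK] with t ht
    have ht' : ‖f' t‖ ≤ K.toNNReal * ‖f t‖ :=
      ht.trans (mul_le_mul_of_nonneg_right (Real.le_coe_toNNReal K) (norm_nonneg _))
    have h00 : f t = 0 → f' t = 0 := fun h => by simpa [h] using ht'
    refine LipschitzOnWith.of_dist_le_mul ?_
    rintro x (rfl | rfl) y (rfl | rfl)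
    · simp
    · by_cases h : f t = 0
      · simp [h, h00 h]
      · simpa [Ne.symm h] using ht'
    · by_cases h : f t = 0
      · simp [h, h00 h]
      · simpa [Ne.symm h] using ht'
    · simp
  · filter_upwards [hf] with t ht
    exact ⟨by simpa using ht, by simp⟩
  · filter_upwards [hK] with t ht
    refine ⟨?_, by simp⟩
    have : (if (0 : E) = f t then f' t else 0) = 0 := by
      split_ifs with h
      · simpa [← h] using ht
      · rfl
    rw [this]
    exact hasDerivAt_const t (0 : E)

variable {V : Type*} [NormedAddCommGroup V] [NormedSpace ℝ V]

/-- The Christoffel symbols of the first kind of a field of bilinear forms on a vector space. -/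
def christoffelForm (B : V → V →L[ℝ] V →L[ℝ] ℝ) (y u v w : V) : ℝ :=
  (fderiv ℝ B y u v w + fderiv ℝ B y v u w - fderiv ℝ B y w u v) / 2

/-- The Hessian of `f` with respect to the metric `B`, if `ξ` is the gradient of `f` at `y`. -/
def coordHessian (B : V → V →L[ℝ] V →L[ℝ] ℝ) (f : V → ℝ) (y u v ξ : V) : ℝ :=
  fderiv ℝ (fderiv ℝ f) y u v - christoffelForm B y u v ξ

theorem fderiv_clm_apply₂ {B : V → V →L[ℝ] V →L[ℝ] ℝ} {y : V} (hB : DifferentiableAt ℝ B y)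
    (u v w : V) : fderiv ℝ (fun z => B z v w) y u = fderiv ℝ B y u v w := by
  have h := ((hB.hasFDerivAt.clm_apply (hasFDerivAt_const v y)).clm_apply
    (hasFDerivAt_const w y)).fderiv
  rw [h]
  simp

/-- The product rule. The last two terms are the inhomogeneous part of the transformation law of the
Christoffel symbols. -/
theorem fderiv_pullback_apply {B B' : V → V →L[ℝ] V →L[ℝ] ℝ} {φ : V → V} {y : V}
    (hφ : ContDiffAt ℝ 2 φ y) (hB : DifferentiableAt ℝ B (φ y)) (hBd : DifferentiableAt ℝ B' y)
    (hB' : ∀ᶠ z in 𝓝 y, ∀ u v, B' z u v = B (φ z) (fderiv ℝ φ z u) (fderiv ℝ φ z v)) (w u v : V) :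
    fderiv ℝ B' y w u v =
      fderiv ℝ B (φ y) (fderiv ℝ φ y w) (fderiv ℝ φ y u) (fderiv ℝ φ y v)
      + B (φ y) (fderiv ℝ (fderiv ℝ φ) y w u) (fderiv ℝ φ y v)
      + B (φ y) (fderiv ℝ φ y u) (fderiv ℝ (fderiv ℝ φ) y w v) := by
  rw [← fderiv_clm_apply₂ hBd]
  have h1 : HasFDerivAt φ (fderiv ℝ φ y) y := (hφ.differentiableAt (by simp)).hasFDerivAt
  have h2 : HasFDerivAt (fderiv ℝ φ) (fderiv ℝ (fderiv ℝ φ) y) y :=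
    ((hφ.fderiv_right (m := 1) (by norm_num)).differentiableAt (by simp)).hasFDerivAt
  have hc : HasFDerivAt (fun z => B (φ z)) ((fderiv ℝ B (φ y)).comp (fderiv ℝ φ y)) y :=
    hB.hasFDerivAt.comp y h1
  have hu : ∀ u, HasFDerivAt (fun z => fderiv ℝ φ z u) ((fderiv ℝ (fderiv ℝ φ) y).flip u) y :=
    fun u => by simpa using h2.clm_apply (hasFDerivAt_const u y)
  have h3 := (hc.clm_apply (hu u)).clm_apply (hu v)
  have h4 : (fun z => B' z u v) =ᶠ[𝓝 y]
      fun z => B (φ z) (fderiv ℝ φ z u) (fderiv ℝ φ z v) := by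
    filter_upwards [hB'] with z hz using hz u v
  rw [h4.fderiv_eq, h3.fderiv]
  simp
  ring

/-- Invariance of the Hessian under a change of coordinates. -/
theorem coordHessian_comp {B B' : V → V →L[ℝ] V →L[ℝ] ℝ} {φ : V → V} {y : V} {f f' : V → ℝ}
    (hφ : ContDiffAt ℝ 2 φ y) (hB : DifferentiableAt ℝ B (φ y)) (hBd : DifferentiableAt ℝ B' y)
    (hB' : ∀ᶠ z in 𝓝 y, ∀ u v, B' z u v = B (φ z) (fderiv ℝ φ z u) (fderiv ℝ φ z v))
    (hsymm : ∀ u v, B (φ y) u v = B (φ y) v u) (hf : ContDiffAt ℝ 2 f (φ y))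
    (hf' : f' =ᶠ[𝓝 y] f ∘ φ)
    {ξ : V} (hξ : ∀ w, fderiv ℝ f (φ y) w = B (φ y) (fderiv ℝ φ y ξ) w) (u v : V) :
    coordHessian B' f' y u v ξ =
      coordHessian B f (φ y) (fderiv ℝ φ y u) (fderiv ℝ φ y v) (fderiv ℝ φ y ξ) := by
  have h1 : HasFDerivAt φ (fderiv ℝ φ y) y := (hφ.differentiableAt (by simp)).hasFDerivAt
  have h2 : HasFDerivAt (fderiv ℝ φ) (fderiv ℝ (fderiv ℝ φ) y) y :=
    ((hφ.fderiv_right (m := 1) (by norm_num)).differentiableAt (by simp)).hasFDerivAt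
  have hf1 : HasFDerivAt (fderiv ℝ f) (fderiv ℝ (fderiv ℝ f) (φ y)) (φ y) :=
    ((hf.fderiv_right (m := 1) (by norm_num)).differentiableAt (by simp)).hasFDerivAt
  have hD : fderiv ℝ (fderiv ℝ f') y u v =
      fderiv ℝ (fderiv ℝ f) (φ y) (fderiv ℝ φ y u) (fderiv ℝ φ y v)
      + fderiv ℝ f (φ y) (fderiv ℝ (fderiv ℝ φ) y u v) := by
    have e : fderiv ℝ f' =ᶠ[𝓝 y] fun z => (fderiv ℝ f (φ z)).comp (fderiv ℝ φ z) := by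
      have hfe : ∀ᶠ z in 𝓝 y, DifferentiableAt ℝ f (φ z) :=
        hφ.continuousAt.eventually ((hf.eventually (by simp)).mono
          fun z hz => hz.differentiableAt (by simp))
      have hφe : ∀ᶠ z in 𝓝 y, DifferentiableAt ℝ φ z :=
        (hφ.eventually (by simp)).mono fun z hz => hz.differentiableAt (by simp)
      filter_upwards [hf'.eventuallyEq_nhds, hfe, hφe] with z hz hz1 hz2
      rw [hz.fderiv_eq, fderiv_comp z hz1 hz2]
    have hc : HasFDerivAt (fun z => fderiv ℝ f (φ z))
        ((fderiv ℝ (fderiv ℝ f) (φ y)).comp (fderiv ℝ φ y)) y := hf1.comp y h1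
    rw [e.fderiv_eq, (hc.clm_comp h2).fderiv]
    simp
    ring
  have hS : ∀ a b, fderiv ℝ (fderiv ℝ φ) y a b = fderiv ℝ (fderiv ℝ φ) y b a := fun a b =>
    (hφ.isSymmSndFDerivAt (by simp)) a b
  -- By symmetry of `D²φ` and of `B`, the inhomogeneous terms of the Christoffel symbol add up to
  -- `B(D²φ(u, v), φ' ξ)`. This is `df(D²φ(u, v))` because `φ' ξ` is the gradient of `f`, and so it
  -- cancels the extra term of the second derivative of `f ∘ φ`.
  unfold coordHessian christoffelForm
  simp only [fderiv_pullback_apply hφ hB hBd hB', hD, hξ]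
  rw [hS v u, hS ξ u, hS ξ v, hsymm (fderiv ℝ φ y v) (fderiv ℝ (fderiv ℝ φ) y u ξ),
    hsymm (fderiv ℝ φ y ξ)]
  ring

/-- If `k` vanishes on the regular level set `{f = 0}`, then so does its derivative along vectors
tangent to the level set. -/
theorem fderiv_apply_eq_zero_of_eq_zero [CompleteSpace V] {f k : V → ℝ} {y v : V}
    (hf : ContDiffAt ℝ 1 f y) (hk : ContDiffAt ℝ 1 k y) (hf' : fderiv ℝ f y ≠ 0) (hy : f y = 0)
    (hfk : ∀ᶠ z in 𝓝 y, f z = 0 → k z = 0) (hv : fderiv ℝ f y v = 0) : fderiv ℝ k y v = 0 := by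
  -- Being constant on the level set, `k` has a constrained extremum at `y`. Lagrange multipliers
  -- make `dk` a multiple of `df`, since `df ≠ 0` excludes a zero coefficient of `dk`.
  have hext : IsLocalExtrOn k {x | f x = f y} y := by
    left
    filter_upwards [mem_nhdsWithin_of_mem_nhds hfk, self_mem_nhdsWithin] with z hz hzy
    rw [hz (hzy.trans hy), hfk.self_of_nhds hy]
  obtain ⟨a, b, hab, h⟩ := hext.exists_multipliers_of_hasStrictFDerivAt_1d
    (hf.hasStrictFDerivAt (by simp)) (hk.hasStrictFDerivAt (by simp))
  have hb : b ≠ 0 := by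
    rintro rfl
    have ha : a ≠ 0 := fun ha => hab (by simp [ha])
    exact hf' (by simpa [ha] using h)
  have := congrArg (fun l => l v) h
  simpa [hv, hb] using this

/-- On a geodesic the geodesic equation, tested against the gradient, turns `df(a)` into `-Γ(w, w,
grad f)`; the derivative is then the Hessian of `f` on the velocity. -/
theorem hasDerivAt_fderiv_comp {f : V → ℝ} {c w : ℝ → V} {a : V} {s : ℝ}
    (hf : ContDiffAt ℝ 2 f (c s)) (hc : HasDerivAt c (w s) s) (hw : HasDerivAt w a s) :
    HasDerivAt (fun s => fderiv ℝ f (c s) (w s))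
      (fderiv ℝ (fderiv ℝ f) (c s) (w s) (w s) + fderiv ℝ f (c s) a) s := by
  have hf1 : HasFDerivAt (fderiv ℝ f) (fderiv ℝ (fderiv ℝ f) (c s)) (c s) :=
    ((hf.fderiv_right (m := 1) (by norm_num)).differentiableAt (by simp)).hasFDerivAt
  exact (hf1.comp_hasDerivAt s hc).clm_apply hw

/-- The length of the velocity is constant along a solution of the geodesic equation. -/
theorem hasDerivAt_metric_velocity {B : V → V →L[ℝ] V →L[ℝ] ℝ} {c w : ℝ → V} {a : V} {s : ℝ}
    (hB : DifferentiableAt ℝ B (c s)) (hsymm : ∀ u v, B (c s) u v = B (c s) v u)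
    (hc : HasDerivAt c (w s) s) (hw : HasDerivAt w a s)
    (hgeo : B (c s) a (w s) + christoffelForm B (c s) (w s) (w s) (w s) = 0) :
    HasDerivAt (fun s => B (c s) (w s) (w s)) 0 s := by
  have hBc : HasDerivAt (fun s => B (c s)) (fderiv ℝ B (c s) (w s)) s :=
    hB.hasFDerivAt.comp_hasDerivAt s hc
  refine ((hBc.clm_apply hw).clm_apply hw).congr_deriv ?_
  rw [christoffelForm] at hgeo
  simp only [add_apply]
  rw [hsymm (w s) a]
  linarith

/-- Picard–Lindelöf for the first order system `(c, w)' = (w, a(c, w))`, on an interval short enough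
for the curve to stay in `U`. The equation shows that `(c, w)` is of class `C¹`, and then `c' = w`
makes `c` of class `C²`, the regularity demanded of geodesics. -/
theorem exists_second_order_solution [CompleteSpace V] {a : V × V → V} {U : Set V}
    (hU : IsOpen U) (ha : ContDiffOn ℝ 1 a (U ×ˢ univ)) {y : V} (hy : y ∈ U) (v : V) :
    ∃ ε > 0, ∃ c w : ℝ → V, c 0 = y ∧ w 0 = v ∧
      (∀ s ∈ Ioo (-ε) ε, c s ∈ U ∧ HasDerivAt c (w s) s ∧ HasDerivAt w (a (c s, w s)) s) ∧
      ContDiffOn ℝ 2 c (Ioo (-ε) ε) := by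
  have hUo : IsOpen (U ×ˢ (univ : Set V)) := hU.prod isOpen_univ
  have hF : ContDiffOn ℝ 1 (fun p : V × V => (p.2, a p)) (U ×ˢ univ) :=
    contDiffOn_snd.prodMk ha
  have hyv : ((y, v) : V × V) ∈ U ×ˢ (univ : Set V) := ⟨hy, mem_univ _⟩
  obtain ⟨α, hα0, ε, hε, hα⟩ :=
    ContDiffAt.exists_forall_mem_closedBall_exists_eq_forall_mem_Ioo_hasDerivAt₀
      (hF.contDiffAt (hUo.mem_nhds hyv)) 0
  have hcont : ContinuousAt α 0 := (hα 0 (by simp [hε])).continuousAt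
  have hev : ∀ᶠ s in 𝓝 (0 : ℝ), α s ∈ U ×ˢ (univ : Set V) :=
    hcont.eventually (by rw [hα0]; exact hUo.mem_nhds hyv)
  obtain ⟨δ, hδ, hδU⟩ := Metric.eventually_nhds_iff.1 hev
  have hsub : ∀ s ∈ Ioo (-min ε δ) (min ε δ), α s ∈ U ×ˢ (univ : Set V) ∧
      HasDerivAt α ((α s).2, a (α s)) s := by
    intro s hs
    have h1 := min_le_left ε δ
    have h2 := min_le_right ε δ
    refine ⟨hδU ?_, hα s ⟨by linarith [hs.1], by linarith [hs.2]⟩⟩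
    rw [Real.dist_eq, sub_zero, abs_lt]
    exact ⟨by linarith [hs.1], by linarith [hs.2]⟩
  have hαc : ContinuousOn α (Ioo (-min ε δ) (min ε δ)) :=
    fun s hs => (hsub s hs).2.continuousAt.continuousWithinAt
  have hmaps : MapsTo α (Ioo (-min ε δ) (min ε δ)) (U ×ˢ univ) := fun s hs => (hsub s hs).1
  have hα1 : ContDiffOn ℝ 1 α (Ioo (-min ε δ) (min ε δ)) := by
    rw [show (1 : WithTop ℕ∞) = 0 + 1 from rfl, contDiffOn_succ_iff_deriv_of_isOpen isOpen_Ioo]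
    refine ⟨fun s hs => (hsub s hs).2.differentiableAt.differentiableWithinAt, by simp, ?_⟩
    rw [contDiffOn_zero]
    exact (hF.continuousOn.comp hαc hmaps).congr fun s hs => (hsub s hs).2.deriv
  have hd1 : ∀ s ∈ Ioo (-min ε δ) (min ε δ), HasDerivAt (fun s => (α s).1) (α s).2 s :=
    fun s hs => (hsub s hs).2.fst
  refine ⟨min ε δ, lt_min hε hδ, fun s => (α s).1, fun s => (α s).2, by simp [hα0], by simp [hα0],
    fun s hs => ⟨(hsub s hs).1.1, hd1 s hs, (hsub s hs).2.snd⟩, ?_⟩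
  rw [show (2 : WithTop ℕ∞) = 1 + 1 from by norm_num,
    contDiffOn_succ_iff_deriv_of_isOpen isOpen_Ioo]
  refine ⟨fun s hs => (hd1 s hs).differentiableAt.differentiableWithinAt, by simp, ?_⟩
  exact (contDiffOn_snd.comp hα1 (fun _ _ => mem_univ _)).congr fun s hs => (hd1 s hs).deriv

/-- The quadratic part of the geodesic equation, as a covector. -/
def geodesicCovector (B : V → V →L[ℝ] V →L[ℝ] ℝ) (p : V × V) : V →L[ℝ] ℝ :=
  fderiv ℝ B p.1 p.2 p.2 - (1 / 2 : ℝ) • ((fderiv ℝ B p.1).flip p.2).flip p.2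

theorem geodesicCovector_apply (B : V → V →L[ℝ] V →L[ℝ] ℝ) (y v w : V) :
    geodesicCovector B (y, v) w = christoffelForm B y v v w := by
  simp only [geodesicCovector, christoffelForm, sub_apply,
    smul_apply, ContinuousLinearMap.flip_apply, smul_eq_mul]
  ring

section FiniteDimensional

variable [FiniteDimensional ℝ V]

/-- A nondegenerate bilinear form as an isomorphism with the dual space. -/
def equivOfNondegenerate (b : V →L[ℝ] V →L[ℝ] ℝ) (hb : ∀ u, (∀ v, b u v = 0) → u = 0) :
    V ≃L[ℝ] (V →L[ℝ] ℝ) :=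
  (LinearEquiv.ofInjectiveOfFinrankEq (b : V →ₗ[ℝ] (V →L[ℝ] ℝ))
    ((injective_iff_map_eq_zero _).2 fun u hu => hb u fun v => by
      have : b u = 0 := hu
      simp [this])
    (by
      rw [← (LinearMap.toContinuousLinearMap : (V →ₗ[ℝ] ℝ) ≃ₗ[ℝ] (V →L[ℝ] ℝ)).finrank_eq]
      exact Subspace.dual_finrank_eq.symm)).toContinuousLinearEquiv

theorem coe_equivOfNondegenerate (b : V →L[ℝ] V →L[ℝ] ℝ)
    (hb : ∀ u, (∀ v, b u v = 0) → u = 0) :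
    (equivOfNondegenerate b hb : V →L[ℝ] (V →L[ℝ] ℝ)) = b := by
  ext u v
  rfl

theorem apply_inverse_apply {b : V →L[ℝ] V →L[ℝ] ℝ} (hb : ∀ u, (∀ v, b u v = 0) → u = 0)
    (l : V →L[ℝ] ℝ) : b (b.inverse l) = l := by
  conv_lhs => rw [← coe_equivOfNondegenerate b hb, ContinuousLinearMap.inverse_equiv]
  exact (equivOfNondegenerate b hb).apply_symm_apply l

/-- In finite dimension a nondegenerate form is an isomorphism onto the dual space, and inversion is
smooth at isomorphisms. This is how indices are raised smoothly. -/
theorem contDiffOn_inverse {n : WithTop ℕ∞} {B : V → V →L[ℝ] V →L[ℝ] ℝ} {U : Set V}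
    (hB : ContDiffOn ℝ n B U) (hb : ∀ y ∈ U, ∀ u, (∀ v, B y u v = 0) → u = 0) :
    ContDiffOn ℝ n (fun y => (B y).inverse) U := by
  intro y hy
  have h := contDiffAt_map_inverse (n := n) (equivOfNondegenerate (B y) (hb y hy))
  rw [coe_equivOfNondegenerate] at h
  exact h.comp_contDiffWithinAt y (hB y hy)

theorem contDiffOn_geodesicCovector {B : V → V →L[ℝ] V →L[ℝ] ℝ} {U : Set V}
    (hU : IsOpen U) (hB : ContDiffOn ℝ ∞ B U) :
    ContDiffOn ℝ ∞ (geodesicCovector B) (U ×ˢ univ) := by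
  have h1 : ContDiffOn ℝ ∞ (fun p : V × V => fderiv ℝ B p.1) (U ×ˢ univ) :=
    (hB.fderiv_of_isOpen hU (m := ∞) (by simp)).comp contDiffOn_fst fun p hp => hp.1
  rw [contDiffOn_clm_apply]
  intro w
  have h2 : ContDiffOn ℝ ∞ (fun p : V × V => fderiv ℝ B p.1 p.2 p.2 w
      - (1 / 2 : ℝ) * fderiv ℝ B p.1 w p.2 p.2) (U ×ˢ univ) :=
    (((h1.clm_apply contDiffOn_snd).clm_apply contDiffOn_snd).clm_apply contDiffOn_const).sub
      (contDiffOn_const.mul (((h1.clm_apply contDiffOn_const).clm_apply contDiffOn_snd).clm_apply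
        contDiffOn_snd))
  refine h2.congr fun p _ => ?_
  simp [geodesicCovector]

/-- Local existence of solutions of the geodesic equation. -/
theorem exists_geodesic_coord {B : V → V →L[ℝ] V →L[ℝ] ℝ} {U : Set V} (hU : IsOpen U)
    (hB : ContDiffOn ℝ ∞ B U) (hb : ∀ y ∈ U, ∀ u, (∀ v, B y u v = 0) → u = 0)
    {y : V} (hy : y ∈ U) (v : V) :
    ∃ ε > 0, ∃ c w a : ℝ → V, c 0 = y ∧ w 0 = v ∧
      (∀ s ∈ Ioo (-ε) ε, c s ∈ U ∧ HasDerivAt c (w s) s ∧ HasDerivAt w (a s) s ∧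
        ∀ z, B (c s) (a s) z + christoffelForm B (c s) (w s) (w s) z = 0) ∧
      ContDiffOn ℝ 2 c (Ioo (-ε) ε) := by
  -- Raising the index solves the lowered geodesic equation for the acceleration.
  let a : V × V → V := fun p => (B p.1).inverse (-geodesicCovector B p)
  have ha : ContDiffOn ℝ 1 a (U ×ˢ univ) :=
    ContDiffOn.of_le ((((contDiffOn_inverse hB hb).comp contDiffOn_fst fun p hp => hp.1 :
      ContDiffOn ℝ ∞ (fun p : V × V => (B p.1).inverse) (U ×ˢ univ))).clm_apply
        (contDiffOn_geodesicCovector hU hB).neg) (by norm_num)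
  obtain ⟨ε, hε, c, w, hc0, hw0, h, hc2⟩ := exists_second_order_solution hU ha hy v
  refine ⟨ε, hε, c, w, fun s => a (c s, w s), hc0, hw0, fun s hs => ?_, hc2⟩
  obtain ⟨h1, h2, h3⟩ := h s hs
  refine ⟨h1, h2, h3, fun z => ?_⟩
  rw [← geodesicCovector_apply, apply_inverse_apply (hb _ h1)]
  simp

end FiniteDimensional

end Calculus

/-! ### Tangent vectors, metrics and Hessians in charts. -/

section Coordinates

set_option maxSynthPendingDepth 3
set_option linter.unusedSectionVars false

theorem two_le_infty : (2 : WithTop ℕ∞) ≤ ∞ := ENat.LEInfty.out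

variable {V : Type*} [NormedAddCommGroup V] [NormedSpace ℝ V]
  {H : Type*} [TopologicalSpace H] {J : ModelWithCorners ℝ V H} [J.Boundaryless]
  {X : Type*} [TopologicalSpace X] [ChartedSpace H X] [IsManifold J ∞ X]

theorem extChartAt_symm_mem_source {q : X} {y : V} (hy : y ∈ (extChartAt J q).target) :
    (extChartAt J q).symm y ∈ (chartAt H q).source := by
  rw [← extChartAt_source (I := J)]
  exact (extChartAt J q).map_target hy

theorem toCoord_ofCoord {q x : X} (hx : x ∈ (chartAt H q).source) (u : V) :
    toCoord (J := J) q x (ofCoord q x u) = u :=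
  (trivializationAt V (TangentSpace J : X → Type _) q).continuousLinearMapAt_symmL
    (by simpa using hx) u

theorem ofCoord_toCoord {q x : X} (hx : x ∈ (chartAt H q).source) (u : TangentSpace J x) :
    ofCoord q x (toCoord q x u) = u :=
  (trivializationAt V (TangentSpace J : X → Type _) q).symmL_continuousLinearMapAt
    (by simpa using hx) u

theorem mdifferentiableAt_extChartAt_symm {q : X} {y : V} (hy : y ∈ (extChartAt J q).target) :
    MDifferentiableAt 𝓘(ℝ, V) J (extChartAt J q).symm y :=
  ((contMDiffOn_extChartAt_symm (n := ∞) q).contMDiffAt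
    ((isOpen_extChartAt_target q).mem_nhds hy)).mdifferentiableAt (by simp)

/-- Without boundary the range of the model is the whole space, so the derivative within the range
that describes the trivialization is an ordinary derivative. -/
theorem ofCoord_eq_mfderiv {q : X} {y : V} (hy : y ∈ (extChartAt J q).target) :
    ofCoord (J := J) q ((extChartAt J q).symm y) =
      mfderiv 𝓘(ℝ, V) J (extChartAt J q).symm y := by
  have h := TangentBundle.symmL_trivializationAt (I := J) (extChartAt_symm_mem_source hy)
  rw [(extChartAt J q).right_inv hy, J.range_eq_univ, mfderivWithin_univ] at h
  exact h

theorem mfderiv_ofCoord {W : Type*} [NormedAddCommGroup W] [NormedSpace ℝ W]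
    {H' : Type*} [TopologicalSpace H'] {J' : ModelWithCorners ℝ W H'}
    {X' : Type*} [TopologicalSpace X'] [ChartedSpace H' X'] {F : X → X'} {q : X} {y : V}
    (hy : y ∈ (extChartAt J q).target)
    (hF : MDifferentiableAt J J' F ((extChartAt J q).symm y)) (u : V) :
    mfderiv J J' F ((extChartAt J q).symm y) (ofCoord q _ u) =
      mfderiv 𝓘(ℝ, V) J' (F ∘ (extChartAt J q).symm) y u := by
  rw [mfderiv_comp y hF (mdifferentiableAt_extChartAt_symm hy), ofCoord_eq_mfderiv hy]
  rfl

theorem mvfderiv_ofCoord {W : Type*} [NormedAddCommGroup W] [NormedSpace ℝ W]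
    {F : X → W} {q x : X} (hx : x ∈ (chartAt H q).source)
    (hF : MDifferentiableAt J 𝓘(ℝ, W) F x) (u : V) :
    mvfderiv J F x (ofCoord q x u) =
      fderiv ℝ (F ∘ (extChartAt J q).symm) (extChartAt J q x) u := by
  have hx' : x ∈ (extChartAt J q).source := by rwa [extChartAt_source]
  obtain ⟨y, hy, rfl⟩ : ∃ y ∈ (extChartAt J q).target, (extChartAt J q).symm y = x :=
    ⟨_, (extChartAt J q).map_source hx', (extChartAt J q).left_inv hx'⟩
  rw [(extChartAt J q).right_inv hy, ← mfderiv_eq_fderiv]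
  exact mfderiv_ofCoord hy hF u

theorem mvfderiv_eq_fderiv_toCoord {W : Type*} [NormedAddCommGroup W] [NormedSpace ℝ W]
    {F : X → W} {q x : X} (hx : x ∈ (chartAt H q).source)
    (hF : MDifferentiableAt J 𝓘(ℝ, W) F x) (u : TangentSpace J x) :
    mvfderiv J F x u =
      fderiv ℝ (F ∘ (extChartAt J q).symm) (extChartAt J q x) (toCoord q x u) := by
  rw [← mvfderiv_ofCoord hx hF, ofCoord_toCoord hx]

theorem toCoord_eq_mvfderiv {q x : X} (hx : x ∈ (chartAt H q).source) (u : TangentSpace J x) :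
    toCoord q x u = mvfderiv J (extChartAt J q) x u := by
  rw [toCoord, TangentBundle.continuousLinearMapAt_trivializationAt hx]
  rfl

theorem toCoord_ofCoord_eq_fderiv {q q' x : X} (hx : x ∈ (chartAt H q).source)
    (hx' : x ∈ (chartAt H q').source) (u : V) :
    toCoord (J := J) q' x (ofCoord q x u) =
      fderiv ℝ (extChartAt J q' ∘ (extChartAt J q).symm) (extChartAt J q x) u := by
  rw [toCoord_eq_mvfderiv hx', mvfderiv_ofCoord hx (mdifferentiableAt_extChartAt hx')]

theorem toCoord_velocity {q : X} {γ : ℝ → X} {s : ℝ} (hs : γ s ∈ (chartAt H q).source)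
    (hγ : MDifferentiableAt 𝓘(ℝ, ℝ) J γ s) :
    toCoord q (γ s) (velocity J γ s) = deriv (fun s => extChartAt J q (γ s)) s := by
  have h1 : MDifferentiableAt J 𝓘(ℝ, V) (extChartAt J q) (γ s) := mdifferentiableAt_extChartAt hs
  have h2 := mfderiv_comp s h1 hγ
  rw [toCoord_eq_mvfderiv hs, ← fderiv_apply_one_eq_deriv, ← mfderiv_eq_fderiv]
  change _ = mfderiv 𝓘(ℝ, ℝ) 𝓘(ℝ, V) (extChartAt J q ∘ γ) s _
  rw [h2]
  rfl

theorem contDiffAt_comp_extChartAt_symm {n : WithTop ℕ∞} (hn : n ≤ ∞) {f : X → ℝ} {q x : X}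
    (hx : x ∈ (chartAt H q).source) (hf : ContMDiffAt J 𝓘(ℝ, ℝ) n f x) :
    ContDiffAt ℝ n (f ∘ (extChartAt J q).symm) (extChartAt J q x) := by
  have hx' : x ∈ (extChartAt J q).source := by rwa [extChartAt_source]
  rw [← contMDiffAt_iff_contDiffAt]
  refine ContMDiffAt.comp (I' := J) _ ?_ ?_
  · rwa [(extChartAt J q).left_inv hx']
  · exact ((contMDiffOn_extChartAt_symm (n := ∞) q).of_le hn).contMDiffAt
      ((isOpen_extChartAt_target q).mem_nhds ((extChartAt J q).map_source hx'))

/-! ### Metrics -/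

/-- A smooth field of nondegenerate symmetric bilinear forms. -/
structure IsSmoothMetric (G : MetricField J X) : Prop where
  add_left : ∀ (p : X) (u u' v : TangentSpace J p), G p (u + u') v = G p u v + G p u' v
  smul_left : ∀ (p : X) (c : ℝ) (u v : TangentSpace J p), G p (c • u) v = c * G p u v
  symm : ∀ (p : X) (u v : TangentSpace J p), G p u v = G p v u
  nondegenerate : ∀ (p : X) (u : TangentSpace J p), (∀ v, G p u v = 0) → u = 0
  smooth : ∀ (q : X) (u v : V),
    ContDiffOn ℝ ∞ (fun y => coordMetric G q y u v) (extChartAt J q).target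

namespace IsSmoothMetric

variable {G : MetricField J X}

theorem add_right (hG : IsSmoothMetric G) (p : X) (u v v' : TangentSpace J p) :
    G p u (v + v') = G p u v + G p u v' := by
  rw [hG.symm, hG.add_left, hG.symm p v, hG.symm p v']

theorem smul_right (hG : IsSmoothMetric G) (p : X) (c : ℝ) (u v : TangentSpace J p) :
    G p u (c • v) = c * G p u v := by
  rw [hG.symm, hG.smul_left, hG.symm]

/-- The metric at a point as a bilinear map. -/
def bilin (hG : IsSmoothMetric G) (p : X) : TangentSpace J p →ₗ[ℝ] TangentSpace J p →ₗ[ℝ] ℝ :=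
  LinearMap.mk₂ ℝ (G p) (hG.add_left p) (hG.smul_left p) (hG.add_right p) (hG.smul_right p)

variable [FiniteDimensional ℝ V]

/-- The components of the metric in a chart, as a bundled bilinear form. -/
def coordForm (hG : IsSmoothMetric G) (q : X) (y : V) : V →L[ℝ] V →L[ℝ] ℝ :=
  LinearMap.toContinuousLinearMap
    ((LinearMap.toContinuousLinearMap : (V →ₗ[ℝ] ℝ) ≃ₗ[ℝ] (V →L[ℝ] ℝ)).toLinearMap ∘ₗ
      (hG.bilin ((extChartAt J q).symm y)).compl₁₂
        (ofCoord q ((extChartAt J q).symm y)).toLinearMap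
        (ofCoord q ((extChartAt J q).symm y)).toLinearMap)

theorem coordForm_apply (hG : IsSmoothMetric G) (q : X) (y u v : V) :
    hG.coordForm q y u v = coordMetric G q y u v := rfl

theorem coordForm_symm (hG : IsSmoothMetric G) (q : X) (y u v : V) :
    hG.coordForm q y u v = hG.coordForm q y v u := hG.symm _ _ _

theorem contDiffOn_coordForm (hG : IsSmoothMetric G) (q : X) :
    ContDiffOn ℝ ∞ (hG.coordForm q) (extChartAt J q).target := by
  rw [contDiffOn_clm_apply]
  intro u
  rw [contDiffOn_clm_apply]
  exact fun v => hG.smooth q u v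

theorem differentiableAt_coordForm (hG : IsSmoothMetric G) {q : X} {y : V}
    (hy : y ∈ (extChartAt J q).target) : DifferentiableAt ℝ (hG.coordForm q) y :=
  ((hG.contDiffOn_coordForm q).contDiffAt ((isOpen_extChartAt_target q).mem_nhds hy)).differentiableAt
    (by simp)

theorem christoffel_eq (hG : IsSmoothMetric G) {q : X} {y : V}
    (hy : y ∈ (extChartAt J q).target) (u v w : V) :
    christoffel G q y u v w = christoffelForm (hG.coordForm q) y u v w := by
  unfold christoffelForm
  simp only [← fderiv_clm_apply₂ (hG.differentiableAt_coordForm hy)]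
  rfl

theorem coordForm_nondegenerate (hG : IsSmoothMetric G) {q : X} {y : V}
    (hy : y ∈ (extChartAt J q).target) (u : V) (hu : ∀ v, hG.coordForm q y u v = 0) : u = 0 := by
  have hx := extChartAt_symm_mem_source hy
  have h : ofCoord (J := J) q ((extChartAt J q).symm y) u = 0 := by
    refine hG.nondegenerate _ _ fun v => ?_
    rw [← ofCoord_toCoord hx v]
    exact hu _
  rw [← toCoord_ofCoord (J := J) hx u, h, map_zero]

theorem coordForm_toCoord (hG : IsSmoothMetric G) {q x : X} (hx : x ∈ (chartAt H q).source)
    (u v : TangentSpace J x) :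
    hG.coordForm q (extChartAt J q x) (toCoord q x u) (toCoord q x v) = G x u v := by
  have hx' : x ∈ (extChartAt J q).source := by rwa [extChartAt_source]
  rw [coordForm_apply, coordMetric, (extChartAt J q).left_inv hx', ofCoord_toCoord hx,
    ofCoord_toCoord hx]

end IsSmoothMetric

/-- `ξ` is the gradient of `f` at `x`. -/
def IsGradient (G : MetricField J X) (f : X → ℝ) (x : X) (ξ : TangentSpace J x) : Prop :=
  ∀ v, G x ξ v = mvfderiv J f x v

variable [FiniteDimensional ℝ V]

/-- The Hessian of `f` at `x`, computed in the chart around `q`, if `ξ` is the gradient of `f`. -/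
def hessianAt {G : MetricField J X} (hG : IsSmoothMetric G) (q : X) (f : X → ℝ) (x : X)
    (ξ u v : TangentSpace J x) : ℝ :=
  coordHessian (hG.coordForm q) (f ∘ (extChartAt J q).symm) (extChartAt J q x)
    (toCoord q x u) (toCoord q x v) (toCoord q x ξ)

/-- The Hessian does not depend on the chart. -/
theorem hessianAt_eq {G : MetricField J X} (hG : IsSmoothMetric G) {q q' x : X} {f : X → ℝ}
    (hx : x ∈ (chartAt H q).source) (hx' : x ∈ (chartAt H q').source)
    (hf : ContMDiffAt J 𝓘(ℝ, ℝ) ∞ f x) {ξ : TangentSpace J x} (hξ : IsGradient G f x ξ)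
    (u v : TangentSpace J x) : hessianAt hG q f x ξ u v = hessianAt hG q' f x ξ u v := by
  have hxs : x ∈ (extChartAt J q).source := by rwa [extChartAt_source]
  have hxs' : x ∈ (extChartAt J q').source := by rwa [extChartAt_source]
  set φ := extChartAt J q with hφ
  set ψ := extChartAt J q' with hψ
  have hsymm : φ.symm (φ x) = x := φ.left_inv hxs
  have hsymm' : ψ.symm (ψ x) = x := ψ.left_inv hxs'
  have ht : φ x ∈ φ.target := φ.map_source hxs
  have hev : ∀ᶠ z in 𝓝 (φ x), z ∈ φ.target ∧ φ.symm z ∈ (chartAt H q').source := by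
    refine ((isOpen_extChartAt_target q).eventually_mem ht).and ?_
    have : ContinuousAt φ.symm (φ x) := (mdifferentiableAt_extChartAt_symm ht).continuousAt
    refine this.eventually ?_
    rw [hsymm]
    exact (chartAt H q').open_source.mem_nhds hx'
  have hT : ContDiffAt ℝ ∞ (ψ ∘ φ.symm) (φ x) := by
    rw [← contMDiffAt_iff_contDiffAt]
    refine ContMDiffAt.comp (I' := J) _ ?_ ?_
    · rw [hsymm]
      exact contMDiffAt_extChartAt' hx'
    · exact (contMDiffOn_extChartAt_symm (n := ∞) q).contMDiffAt
        ((isOpen_extChartAt_target q).mem_nhds ht)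
  have hTx : (ψ ∘ φ.symm) (φ x) = ψ x := by simp [hsymm]
  -- The derivative of the transition map converts components in one chart into components in the
  -- other, so `coordHessian_comp` for the transition map gives the claim.
  have hD : ∀ w : TangentSpace J x,
      fderiv ℝ (ψ ∘ φ.symm) (φ x) (toCoord q x w) = toCoord q' x w := fun w => by
    rw [← toCoord_ofCoord_eq_fderiv hx hx', ofCoord_toCoord hx]
  have key := coordHessian_comp (φ := ψ ∘ φ.symm) (y := φ x) (B := hG.coordForm q')
    (B' := hG.coordForm q) (f := f ∘ ψ.symm) (f' := f ∘ φ.symm) (ξ := toCoord q x ξ)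
    (hT.of_le two_le_infty)
    (by rw [hTx]; exact hG.differentiableAt_coordForm (ψ.map_source hxs'))
    (hG.differentiableAt_coordForm ht) ?_ (hG.coordForm_symm q' _)
    (by
      rw [hTx]
      exact (contDiffAt_comp_extChartAt_symm le_rfl hx' hf).of_le two_le_infty) ?_ ?_
    (toCoord q x u) (toCoord q x v)
  · rw [hD, hD, hD, hTx] at key
    exact key
  · filter_upwards [hev] with z hz u v
    have hzq := extChartAt_symm_mem_source hz.1
    have hr : φ (φ.symm z) = z := φ.right_inv hz.1
    have h1 := toCoord_ofCoord_eq_fderiv (J := J) hzq hz.2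
    rw [← hφ, ← hψ, hr] at h1
    rw [← h1, ← h1]
    exact (hG.coordForm_toCoord hz.2 _ _).symm
  · filter_upwards [hev] with z hz
    have : φ.symm z ∈ ψ.source := by rw [hψ, extChartAt_source]; exact hz.2
    simp [ψ.left_inv this]
  · intro w
    rw [hD, hTx, ← toCoord_ofCoord (J := J) hx' w, hG.coordForm_toCoord hx', hξ,
      mvfderiv_ofCoord hx' (hf.mdifferentiableAt (by simp)), toCoord_ofCoord hx']

end Coordinates

/-! ### Traces with respect to a nondegenerate form. -/

section Trace

/-- A kernel vector of the Gram matrix would give the coordinates of a nonzero vector in the radical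
of `B`. -/
theorem gram_det_ne_zero {W : Type*} [AddCommGroup W] [Module ℝ W] {ι : Type*} [Fintype ι]
    [DecidableEq ι] (b : Module.Basis ι ℝ W) (B : W →ₗ[ℝ] W →ₗ[ℝ] ℝ)
    (hB : ∀ u, (∀ v, B v u = 0) → u = 0) :
    (Matrix.of fun k l => B (b k) (b l)).det ≠ 0 := by
  intro hdet
  obtain ⟨v, hv, hMv⟩ := Matrix.exists_mulVec_eq_zero_iff.2 hdet
  have hu : ∑ i, v i • b i = 0 := by
    refine hB _ fun w => ?_
    have hk : ∀ k, B (b k) (∑ i, v i • b i) = 0 := fun k => by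
      have := congrFun hMv k
      simp only [Matrix.mulVec, dotProduct, Matrix.of_apply, Pi.zero_apply] at this
      simp only [map_sum, map_smul, smul_eq_mul]
      rw [← this]
      exact Finset.sum_congr rfl fun i _ => mul_comm _ _
    generalize ∑ i, v i • b i = z at hk
    rw [← b.sum_repr w]
    simp only [map_sum, map_smul, LinearMap.sum_apply, LinearMap.smul_apply, hk, smul_zero,
      Finset.sum_const_zero]
  exact hv (funext fun i => Fintype.linearIndependent_iff.1 b.linearIndependent v hu i)

variable {W : Type*} [AddCommGroup W] [Module ℝ W] [FiniteDimensional ℝ W]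

/-- Each row contributes a diagonal entry of `c A⁻¹ A`, where `A` is the Gram matrix. Definiteness
plays no role, so Lorentzian induced metrics are covered. -/
theorem metricTrace_smul_self (B : W →ₗ[ℝ] W →ₗ[ℝ] ℝ) (hB : ∀ u, (∀ v, B v u = 0) → u = 0)
    (hsymm : ∀ u v, B u v = B v u) (c : ℝ) {h : W → W → ℝ} (hh : ∀ u v, h u v = c * B u v) :
    metricTrace (fun u v => B u v) h = c * Module.finrank ℝ W := by
  set b := Module.finBasis ℝ W with hb
  set A : Matrix _ _ ℝ := Matrix.of fun k l => B (b k) (b l) with hA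
  have hdet : IsUnit A.det := (gram_det_ne_zero b B hB).isUnit
  have h1 : ∀ i, ∑ j, A⁻¹ i j * h (b i) (b j) = c := fun i => by
    have : ∑ j, A⁻¹ i j * h (b i) (b j) = c * (A⁻¹ * A) i i := by
      rw [Matrix.mul_apply, Finset.mul_sum]
      refine Finset.sum_congr rfl fun j _ => ?_
      rw [hh, hsymm, hA, Matrix.of_apply]
      ring
    rw [this, Matrix.nonsing_inv_mul _ hdet, Matrix.one_apply_eq, mul_one]
  change ∑ i, ∑ j, A⁻¹ i j * h (b i) (b j) = _
  simp only [h1, Finset.sum_const, Finset.card_univ, Fintype.card_fin, nsmul_eq_mul]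
  ring

/-- Applying the inverse Gram matrix to the components of `α` gives the components of `ξ`, the
vector dual to `α`. -/
theorem metricTrace_mul_self (B : W →ₗ[ℝ] W →ₗ[ℝ] ℝ) (hB : ∀ u, (∀ v, B v u = 0) → u = 0)
    (hsymm : ∀ u v, B u v = B v u) (α : W →ₗ[ℝ] ℝ) (ξ : W) (hξ : ∀ v, B ξ v = α v) :
    metricTrace (fun u v => B u v) (fun u v => α u * α v) = α ξ := by
  set b := Module.finBasis ℝ W with hb
  set A : Matrix _ _ ℝ := Matrix.of fun k l => B (b k) (b l) with hA
  have hdet : IsUnit A.det := (gram_det_ne_zero b B hB).isUnit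
  have hα : (fun j => α (b j)) = A.mulVec (b.repr ξ) := by
    funext j
    rw [← hξ, hsymm]
    conv_lhs => rw [← b.sum_repr ξ]
    simp only [map_sum, map_smul, smul_eq_mul, Matrix.mulVec, dotProduct, hA, Matrix.of_apply]
    exact Finset.sum_congr rfl fun i _ => mul_comm _ _
  have h1 : ∀ i, ∑ j, A⁻¹ i j * α (b j) = b.repr ξ i := fun i => by
    have : A⁻¹.mulVec (fun j => α (b j)) = b.repr ξ := by
      rw [hα, Matrix.mulVec_mulVec, Matrix.nonsing_inv_mul _ hdet, Matrix.one_mulVec]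
    exact congrFun this i
  change ∑ i, ∑ j, A⁻¹ i j * (α (b i) * α (b j)) = _
  conv_rhs => rw [← b.sum_repr ξ]
  simp only [map_sum, map_smul, smul_eq_mul]
  refine Finset.sum_congr rfl fun i _ => ?_
  rw [← h1 i, Finset.sum_mul]
  exact Finset.sum_congr rfl fun j _ => by ring

end Trace

/-! ### Hypersurfaces as level sets: tangent spaces, second fundamental form, mean curvature. -/

section Hypersurface

set_option maxSynthPendingDepth 3
set_option linter.unusedSectionVars false

variable {V : Type*} [NormedAddCommGroup V] [NormedSpace ℝ V] [FiniteDimensional ℝ V]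
  {H : Type*} [TopologicalSpace H] {J : ModelWithCorners ℝ V H} [J.Boundaryless]
  {X : Type*} [TopologicalSpace X] [ChartedSpace H X] [IsManifold J ∞ X]

/-- `f` is a smooth function on the open set `U` without critical points, and `S` is its zero set
in `U`. -/
structure IsDefiningFunction (J : ModelWithCorners ℝ V H) (S U : Set X) (f : X → ℝ) : Prop where
  isOpen : IsOpen U
  contMDiffOn : ContMDiffOn J 𝓘(ℝ, ℝ) ∞ f U
  ne_zero : ∀ x ∈ U, mvfderiv J f x ≠ 0
  inter_eq : S ∩ U = {x ∈ U | f x = 0}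

theorem IsHypersurface.exists_isDefiningFunction {S : Set X} (hS : IsHypersurface J S) {p : X}
    (hp : p ∈ S) : ∃ U f, p ∈ U ∧ IsDefiningFunction J S U f := by
  obtain ⟨U, hU, hpU, f, hf, hne, heq⟩ := hS p hp
  exact ⟨U, f, hpU, hU, hf, hne, heq⟩

namespace IsDefiningFunction

variable {S U : Set X} {f : X → ℝ}

theorem contMDiffAt (hf : IsDefiningFunction J S U f) {x : X} (hx : x ∈ U) :
    ContMDiffAt J 𝓘(ℝ, ℝ) ∞ f x :=
  hf.contMDiffOn.contMDiffAt (hf.isOpen.mem_nhds hx)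

theorem mdifferentiableAt (hf : IsDefiningFunction J S U f) {x : X} (hx : x ∈ U) :
    MDifferentiableAt J 𝓘(ℝ, ℝ) f x :=
  (hf.contMDiffAt hx).mdifferentiableAt (by simp)

theorem mem_iff (hf : IsDefiningFunction J S U f) {x : X} (hx : x ∈ U) : x ∈ S ↔ f x = 0 := by
  have := Set.ext_iff.1 hf.inter_eq x
  simpa [hx] using this

theorem contDiffAt_coord (hf : IsDefiningFunction J S U f) {q x : X} (hx : x ∈ U)
    (hq : x ∈ (chartAt H q).source) :
    ContDiffAt ℝ ∞ (f ∘ (extChartAt J q).symm) (extChartAt J q x) :=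
  contDiffAt_comp_extChartAt_symm le_rfl hq (hf.contMDiffAt hx)

theorem fderiv_coord_ne_zero (hf : IsDefiningFunction J S U f) {q x : X} (hx : x ∈ U)
    (hq : x ∈ (chartAt H q).source) :
    fderiv ℝ (f ∘ (extChartAt J q).symm) (extChartAt J q x) ≠ 0 := by
  intro h0
  apply hf.ne_zero x hx
  ext v
  rw [mvfderiv_eq_fderiv_toCoord hq (hf.mdifferentiableAt hx), h0]
  simp

theorem eventually_coord {p q : X} (hU : IsOpen U) (hp : p ∈ U) (hq : p ∈ (chartAt H q).source) :
    ∀ᶠ z in 𝓝 (extChartAt J q p), z ∈ (extChartAt J q).target ∧ (extChartAt J q).symm z ∈ U := by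
  have hps : p ∈ (extChartAt J q).source := by rwa [extChartAt_source]
  have ht := (extChartAt J q).map_source hps
  refine ((isOpen_extChartAt_target q).eventually_mem ht).and ?_
  have : ContinuousAt (extChartAt J q).symm (extChartAt J q p) :=
    (mdifferentiableAt_extChartAt_symm ht).continuousAt
  refine this.eventually ?_
  rw [(extChartAt J q).left_inv hps]
  exact hU.mem_nhds hp

/-- The differential of any function vanishing on `S` is a multiple of that of a defining function,
so testing the latter alone suffices. -/
theorem mem_tangentSpaceOf_iff (hf : IsDefiningFunction J S U f) {p : X} (hp : p ∈ S)
    (hpU : p ∈ U) {v : TangentSpace J p} :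
    v ∈ tangentSpaceOf J S p ↔ mvfderiv J f p v = 0 := by
  constructor
  · intro hv
    exact hv U hf.isOpen hpU f hf.contMDiffOn fun x hx => (hf.mem_iff hx.2).1 hx.1
  · intro hv U' hU' hpU' k hk hk0
    have hps : p ∈ (chartAt H p).source := mem_chart_source H p
    have hkp : ContMDiffAt J 𝓘(ℝ, ℝ) ∞ k p := hk.contMDiffAt (hU'.mem_nhds hpU')
    rw [mvfderiv_eq_fderiv_toCoord hps (hkp.mdifferentiableAt (by simp))]
    rw [mvfderiv_eq_fderiv_toCoord hps (hf.mdifferentiableAt hpU)] at hv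
    refine fderiv_apply_eq_zero_of_eq_zero ((hf.contDiffAt_coord hpU hps).of_le (by norm_num))
      ((contDiffAt_comp_extChartAt_symm le_rfl hps hkp).of_le (by norm_num))
      (hf.fderiv_coord_ne_zero hpU hps) ?_ ?_ hv
    · simpa using (hf.mem_iff hpU).1 hp
    · filter_upwards [eventually_coord (J := J) (hf.isOpen.inter hU') ⟨hpU, hpU'⟩ hps] with z hz hz0
      exact hk0 _ ⟨(hf.mem_iff hz.2.1).2 hz0, hz.2.2⟩

theorem finrank_tangentSpaceOf (hf : IsDefiningFunction J S U f) {p : X} (hp : p ∈ S)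
    (hpU : p ∈ U) : Module.finrank ℝ (tangentSpaceOf J S p) + 1 = Module.finrank ℝ V := by
  have h1 : tangentSpaceOf J S p = (mvfderiv J f p).toLinearMap.ker := by
    ext v
    rw [hf.mem_tangentSpaceOf_iff hp hpU]
    rfl
  have hsurj : Function.Surjective (mvfderiv J f p).toLinearMap := by
    refine LinearMap.surjective fun h => hf.ne_zero p hpU ?_
    ext v
    exact LinearMap.congr_fun h v
  have h2 := (mvfderiv J f p).toLinearMap.finrank_range_add_finrank_ker
  rw [LinearMap.range_eq_top.2 hsurj, finrank_top, Module.finrank_self] at h2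
  rw [h1, add_comm, h2]
  rfl

/-- `secondFundamentalForm` picks an extension with `Classical.epsilon`; existence guarantees that
the chosen field really is a tangent extension. -/
theorem exists_isTangentExtension (hf : IsDefiningFunction J S U f) {p : X} (hp : p ∈ S)
    (hpU : p ∈ U) {w : TangentSpace J p} (hw : w ∈ tangentSpaceOf J S p) :
    ∃ Y, IsTangentExtension S p w Y := by
  have hps : p ∈ (chartAt H p).source := mem_chart_source H p
  have hpe : p ∈ (extChartAt J p).source := by rwa [extChartAt_source]
  set φ := extChartAt J p with hφ
  set F : V → ℝ := f ∘ φ.symm with hF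
  obtain ⟨e, he⟩ : ∃ e, fderiv ℝ F (φ p) e ≠ 0 := by
    by_contra! h
    exact hf.fderiv_coord_ne_zero hpU hps (ContinuousLinearMap.ext h)
  set w' : V := toCoord p p w
  -- The constant field `w'` is corrected in the transversal direction `e` so that `dF` annihilates
  -- it. The correction vanishes at `p` because `w` is tangent there.
  let k : V → V := fun z => w' - (fderiv ℝ F z w' / fderiv ℝ F z e) • e
  have hFd : ContDiffAt ℝ ∞ (fderiv ℝ F) (φ p) :=
    (hf.contDiffAt_coord hpU hps).fderiv_right (by simp)
  have hke : ∀ᶠ x in 𝓝 p, x ∈ U ∧ x ∈ (chartAt H p).source ∧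
      fderiv ℝ F (φ x) e ≠ 0 := by
    refine (hf.isOpen.eventually_mem hpU).and
      (((chartAt H p).open_source.eventually_mem hps).and ?_)
    have : ContinuousAt (fun x => fderiv ℝ F (φ x) e) p :=
      (ContinuousAt.comp (f := φ) (g := fderiv ℝ F) (x := p) hFd.continuousAt
        (continuousAt_extChartAt p)).clm_apply continuousAt_const
    exact this.eventually_ne he
  refine ⟨fun x => ofCoord p x (k (φ x)), ?_, ?_, ?_⟩
  · filter_upwards [hke] with x₀ hx₀
    have hsrc : x₀ ∈ (trivializationAt V (TangentSpace J : X → Type _) p).baseSet := by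
      simpa using hx₀.2.1
    rw [Trivialization.contMDiffAt_section_iff _ hsrc]
    have hk : ContDiffAt ℝ ∞ k (φ x₀) := by
      have hFd₀ : ContDiffAt ℝ ∞ (fderiv ℝ F) (φ x₀) :=
        (hf.contDiffAt_coord hx₀.1 hx₀.2.1).fderiv_right (by simp)
      exact contDiffAt_const.sub
        (((hFd₀.clm_apply contDiffAt_const).div (hFd₀.clm_apply contDiffAt_const) hx₀.2.2).smul
          contDiffAt_const)
    have h1 : ContMDiffAt J 𝓘(ℝ, V) ∞ (k ∘ φ) x₀ :=
      hk.contMDiffAt.comp x₀ (contMDiffAt_extChartAt' hx₀.2.1)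
    refine h1.congr_of_eventuallyEq ?_
    filter_upwards [(chartAt H p).open_source.eventually_mem hx₀.2.1] with x hx
    have h2 := toCoord_ofCoord (J := J) hx (k (φ x))
    have hxb : x ∈ (trivializationAt V (TangentSpace J : X → Type _) p).baseSet := by
      simpa using hx
    rw [toCoord, Trivialization.continuousLinearMapAt_apply, Trivialization.linearMapAt_apply,
      if_pos hxb] at h2
    exact h2
  · filter_upwards [hke] with x hx hxS
    rw [hf.mem_tangentSpaceOf_iff hxS hx.1, mvfderiv_ofCoord hx.2.1 (hf.mdifferentiableAt hx.1)]
    have := hx.2.2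
    simp only [k, map_sub, map_smul, smul_eq_mul]
    exact sub_eq_zero.2 (div_mul_cancel₀ _ this).symm
  · have hw0 : fderiv ℝ F (φ p) w' = 0 := by
      rw [← mvfderiv_eq_fderiv_toCoord hps (hf.mdifferentiableAt hpU)]
      exact (hf.mem_tangentSpaceOf_iff hp hpU).1 hw
    simp only [k, hw0, zero_div, zero_smul, sub_zero, w']
    exact ofCoord_toCoord hps w

variable {G : MetricField J X}

/-- The second fundamental form of a level set is a multiple of the Hessian. -/
theorem secondFundamentalForm_eq (hf : IsDefiningFunction J S U f) (hG : IsSmoothMetric G) {p : X}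
    (hp : p ∈ S) (hpU : p ∈ U) {ξ : TangentSpace J p} (hξ : IsGradient G f p ξ) (a : ℝ)
    {u w : TangentSpace J p} (hu : u ∈ tangentSpaceOf J S p) (hw : w ∈ tangentSpaceOf J S p) :
    secondFundamentalForm G S p (a • ξ) u w = a * hessianAt hG p f p ξ u w := by
  obtain ⟨hY1, hY2, hY3⟩ := Classical.epsilon_spec (hf.exists_isTangentExtension hp hpU hw)
  rw [secondFundamentalForm]
  set Y := Classical.epsilon (IsTangentExtension S p w)
  have hps : p ∈ (chartAt H p).source := mem_chart_source H p
  have hpe : p ∈ (extChartAt J p).source := by rwa [extChartAt_source]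
  have ht : extChartAt J p p ∈ (extChartAt J p).target := (extChartAt J p).map_source hpe
  set φ := extChartAt J p with hφ
  set F : V → ℝ := f ∘ φ.symm with hF
  let cY : V → V := fun z => toCoord p (φ.symm z) (Y (φ.symm z))
  have hcY0 : cY (φ p) = toCoord p p w := by
    have : φ.symm (φ p) = p := φ.left_inv hpe
    change toCoord p (φ.symm (φ p)) (Y (φ.symm (φ p))) = _
    rw [this, hY3]
  have hcY : ContDiffAt ℝ ∞ cY (φ p) := by
    have h1 := (contMDiffAt_section (F := V) (E := (TangentSpace J : X → Type _)) p).1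
      hY1.self_of_nhds
    have h2 : ContMDiffAt J 𝓘(ℝ, V) ∞ (fun x => toCoord p x (Y x)) p := by
      refine h1.congr_of_eventuallyEq ?_
      filter_upwards [(chartAt H p).open_source.eventually_mem hps] with x hx
      have hxb : x ∈ (trivializationAt V (TangentSpace J : X → Type _) p).baseSet := by
        simpa using hx
      rw [toCoord, Trivialization.continuousLinearMapAt_apply, Trivialization.linearMapAt_apply,
        if_pos hxb]
    rw [← contMDiffAt_iff_contDiffAt]
    refine ContMDiffAt.comp (I' := J) (g := fun x => toCoord p x (Y x)) (φ p) ?_ ?_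
    · have : φ.symm (φ p) = p := φ.left_inv hpe
      rwa [this]
    · exact (contMDiffOn_extChartAt_symm (n := ∞) p).contMDiffAt
        ((isOpen_extChartAt_target p).mem_nhds ht)
  have hFd : ContDiffAt ℝ ∞ (fderiv ℝ F) (φ p) :=
    (hf.contDiffAt_coord hpU hps).fderiv_right (by simp)
  have hu0 : fderiv ℝ F (φ p) (toCoord p p u) = 0 := by
    rw [← mvfderiv_eq_fderiv_toCoord hps (hf.mdifferentiableAt hpU)]
    exact (hf.mem_tangentSpaceOf_iff hp hpU).1 hu
  -- The function `dF(Y)` vanishes on the level set, so its derivative along the tangent vector `u`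
  -- is zero: `D²F(u, w) + dF(DY(u)) = 0`. This trades the derivative of `Y` for the second
  -- derivative of `F` and makes the result independent of the extension.
  have hzero : fderiv ℝ (fun z => fderiv ℝ F z (cY z)) (φ p) (toCoord p p u) = 0 := by
    refine fderiv_apply_eq_zero_of_eq_zero ((hf.contDiffAt_coord hpU hps).of_le (by norm_num))
      ((hFd.clm_apply hcY).of_le (by norm_num)) (hf.fderiv_coord_ne_zero hpU hps) ?_ ?_ hu0
    · change f (φ.symm (φ p)) = 0
      rw [φ.left_inv hpe]
      exact (hf.mem_iff hpU).1 hp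
    · obtain ⟨N, hN, hNo, hpN⟩ := eventually_nhds_iff.1 hY2
      filter_upwards [eventually_coord (J := J) (hf.isOpen.inter hNo) ⟨hpU, hpN⟩ hps] with z hz hz0
      have hzS : φ.symm z ∈ S := (hf.mem_iff hz.2.1).2 hz0
      have h3 := (hf.mem_tangentSpaceOf_iff hzS hz.2.1).1 (hN _ hz.2.2 hzS)
      rw [mvfderiv_eq_fderiv_toCoord (extChartAt_symm_mem_source hz.1)
        (hf.mdifferentiableAt hz.2.1), (extChartAt J p).right_inv hz.1] at h3
      exact h3
  have h4 := ((hFd.differentiableAt (by simp)).hasFDerivAt.clm_apply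
    (hcY.differentiableAt (by simp)).hasFDerivAt).fderiv
  rw [h4] at hzero
  simp only [add_apply, ContinuousLinearMap.comp_apply, ContinuousLinearMap.flip_apply,
    hcY0] at hzero
  have hgrad : ∀ v : V, hG.coordForm p (φ p) v (toCoord p p (a • ξ)) = a * fderiv ℝ F (φ p) v := by
    intro v
    rw [← mvfderiv_ofCoord hps (hf.mdifferentiableAt hpU), ← hξ]
    conv_lhs => rw [← toCoord_ofCoord (J := J) hps v]
    rw [hG.coordForm_toCoord hps, hG.smul_right, hG.symm]
  have hcov : covDerivLowered G Y p u (a • ξ) =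
      hG.coordForm p (φ p) (fderiv ℝ cY (φ p) (toCoord p p u)) (toCoord p p (a • ξ)) +
        christoffelForm (hG.coordForm p) (φ p) (toCoord p p u) (cY (φ p))
          (toCoord p p (a • ξ)) := by
    rw [← hG.christoffel_eq ht]
    rfl
  rw [hcov, hgrad, hcY0, hessianAt, coordHessian, christoffelForm, christoffelForm]
  simp only [map_smul, smul_apply, smul_eq_mul]
  linear_combination (-a) * hzero

theorem exists_isGradient (hG : IsSmoothMetric G) (f : X → ℝ) (p : X) :
    ∃ ξ, IsGradient G f p ξ := by
  have hb : Function.Surjective (hG.bilin p) := by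
    have hinj : Function.Injective (hG.bilin p) :=
      (injective_iff_map_eq_zero _).2 fun u hu => hG.nondegenerate p u fun v => by
        exact LinearMap.congr_fun hu v
    exact (LinearMap.injective_iff_surjective_of_finrank_eq_finrank
      (Subspace.dual_finrank_eq (K := ℝ) (V := TangentSpace J p)).symm).1 hinj
  obtain ⟨ξ, hξ⟩ := hb (mvfderiv J f p).toLinearMap
  exact ⟨ξ, fun v => LinearMap.congr_fun hξ v⟩

/-- A unit normal of a level set is a multiple of the gradient. -/
theorem exists_unitNormal_eq_smul (hf : IsDefiningFunction J S U f) (hG : IsSmoothMetric G) {p : X}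
    (hp : p ∈ S) (hpU : p ∈ U) {ξ : TangentSpace J p} (hξ : IsGradient G f p ξ)
    {ν : TangentSpace J p} (hν : IsUnitNormal G S p ν) :
    ∃ a : ℝ, ν = a • ξ ∧ a ≠ 0 := by
  obtain ⟨e, he⟩ : ∃ e, mvfderiv J f p e ≠ 0 := by
    by_contra! h
    exact hf.ne_zero p hpU (by ext v; simpa using h v)
  -- Both `ν` and `a • ξ` are orthogonal to the tangent space; this `a` makes their products with
  -- the transversal vector `e` agree too.
  set a := G p ν e / mvfderiv J f p e with ha
  have key : ν - a • ξ = 0 := by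
    refine hG.nondegenerate p _ fun v => ?_
    have hv : v - (mvfderiv J f p v / mvfderiv J f p e) • e ∈ tangentSpaceOf J S p := by
      rw [hf.mem_tangentSpaceOf_iff hp hpU, map_sub, map_smul, smul_eq_mul, div_mul_cancel₀ _ he,
        sub_self]
    have h1 := hν.1 _ hv
    rw [sub_eq_add_neg, ← neg_smul, hG.add_right, hG.smul_right] at h1
    rw [sub_eq_add_neg, ← neg_smul, hG.add_left, hG.smul_left, hξ, ha]
    field_simp at h1 ⊢
    linarith
  have hνa : ν = a • ξ := sub_eq_zero.1 key
  refine ⟨a, hνa, fun h0 => ?_⟩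
  have h2 := hν.2
  rw [hνa, h0, hG.smul_left] at h2
  simp at h2

/-- The mean curvature of a level set with pure trace Hessian. -/
theorem meanCurvature_eq (hf : IsDefiningFunction J S U f) (hG : IsSmoothMetric G) {p : X}
    (hp : p ∈ S) (hpU : p ∈ U) {ξ : TangentSpace J p} (hξ : IsGradient G f p ξ)
    (hξ0 : G p ξ ξ ≠ 0) {ν : TangentSpace J p} {c : ℝ}
    (hh : ∀ u ∈ tangentSpaceOf J S p, ∀ w ∈ tangentSpaceOf J S p,
      secondFundamentalForm G S p ν u w = c * G p u w) :
    meanCurvature G S p ν = c * (Module.finrank ℝ V - 1) := by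
  have hfin : (Module.finrank ℝ (tangentSpaceOf J S p) : ℝ) = Module.finrank ℝ V - 1 := by
    rw [← hf.finrank_tangentSpaceOf hp hpU]
    push_cast
    ring
  rw [← hfin]
  let T := tangentSpaceOf J S p
  let B : T →ₗ[ℝ] T →ₗ[ℝ] ℝ := (hG.bilin p).domRestrict₁₂ T T
  refine metricTrace_smul_self B ?_ (fun u v => hG.symm p u v) c fun u v => hh u u.2 v v.2
  -- The induced form is nondegenerate because the gradient is not null: a tangent vector orthogonal
  -- to the tangent space is also orthogonal to `ξ`, and these together span everything.
  intro u hu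
  have hut : mvfderiv J f p u = 0 := (hf.mem_tangentSpaceOf_iff hp hpU).1 u.2
  have : (u : TangentSpace J p) = 0 := by
    refine hG.nondegenerate p _ fun v => ?_
    have hξξ : mvfderiv J f p ξ ≠ 0 := by rwa [← hξ]
    have hv : v - (mvfderiv J f p v / mvfderiv J f p ξ) • ξ ∈ tangentSpaceOf J S p := by
      rw [hf.mem_tangentSpaceOf_iff hp hpU, map_sub, map_smul, smul_eq_mul, div_mul_cancel₀ _ hξξ,
        sub_self]
    have h1 : G p (v - (mvfderiv J f p v / mvfderiv J f p ξ) • ξ) u = 0 := hu ⟨_, hv⟩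
    rw [sub_eq_add_neg, ← neg_smul, hG.add_left, hG.smul_left, hξ, hut, mul_zero, add_zero] at h1
    rw [hG.symm, h1]
  exact Subtype.ext this

end IsDefiningFunction

end Hypersurface

/-! ### Null geodesics tangent to a level set. -/

section LevelSets

set_option maxSynthPendingDepth 3

variable {V : Type*} [NormedAddCommGroup V] [NormedSpace ℝ V] [FiniteDimensional ℝ V]
  {B : V → V →L[ℝ] V →L[ℝ] ℝ} {F : V → ℝ} {U : Set V}

/-- The gradient of `F` with respect to the metric `B`. -/
def coordGradient (B : V → V →L[ℝ] V →L[ℝ] ℝ) (F : V → ℝ) (y : V) : V :=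
  (B y).inverse (fderiv ℝ F y)

theorem apply_coordGradient {y : V} (hb : ∀ u, (∀ v, B y u v = 0) → u = 0) (v : V) :
    B y (coordGradient B F y) v = fderiv ℝ F y v := by
  rw [coordGradient, apply_inverse_apply hb]

/-- The Hessian is assumed to vanish only on the tangent null vectors. These form the zero set of
`(y, Z) ↦ (F(y), dF(Z), B(Z, Z))`, which is a submersion at `(y₀, Z₀)`;
`exists_abs_le_mul_norm_of_eq_zero` then controls the Hessian near that set. -/
theorem exists_abs_coordHessian_le (hU : IsOpen U) (hB : ContDiffOn ℝ ∞ B U)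
    (hb : ∀ y ∈ U, ∀ u, (∀ v, B y u v = 0) → u = 0) (hsymm : ∀ y u v, B y u v = B y v u)
    (hF : ContDiffOn ℝ ∞ F U) {y₀ Z₀ : V} (hy₀ : y₀ ∈ U) (hZ₀ : Z₀ ≠ 0) (hF0 : F y₀ = 0)
    (hF1 : fderiv ℝ F y₀ Z₀ = 0) (hnull : B y₀ Z₀ Z₀ = 0)
    (hξ : B y₀ (coordGradient B F y₀) (coordGradient B F y₀) ≠ 0)
    (hK : ∀ y ∈ U, ∀ Z, F y = 0 → fderiv ℝ F y Z = 0 → B y Z Z = 0 →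
      coordHessian B F y Z Z (coordGradient B F y) = 0) :
    ∃ C : ℝ, ∀ᶠ p : V × V in 𝓝 (y₀, Z₀),
      |coordHessian B F p.1 p.2 p.2 (coordGradient B F p.1)| ≤
        C * ‖(F p.1, fderiv ℝ F p.1 p.2, B p.1 p.2 p.2)‖ := by
  have hUn : U ∈ 𝓝 y₀ := hU.mem_nhds hy₀
  have hFd : ContDiffOn ℝ ∞ (fderiv ℝ F) U := hF.fderiv_of_isOpen hU (by simp)
  have hFdd : ContDiffOn ℝ ∞ (fderiv ℝ (fderiv ℝ F)) U := hFd.fderiv_of_isOpen hU (by simp)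
  have hX : ContDiffOn ℝ ∞ (coordGradient B F) U := (contDiffOn_inverse hB hb).clm_apply hFd
  have hfst : MapsTo (Prod.fst : V × V → V) (U ×ˢ univ) U := fun p hp => hp.1
  have hKs : ContDiffOn ℝ ∞ (fun p : V × V =>
      coordHessian B F p.1 p.2 p.2 (coordGradient B F p.1)) (U ×ˢ univ) := by
    have h1 : ContDiffOn ℝ ∞ (fun p : V × V => fderiv ℝ (fderiv ℝ F) p.1) (U ×ˢ univ) :=
      hFdd.comp contDiffOn_fst hfst
    have h2 : ContDiffOn ℝ ∞ (fun p : V × V => coordGradient B F p.1) (U ×ˢ univ) :=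
      hX.comp contDiffOn_fst hfst
    refine (((h1.clm_apply contDiffOn_snd).clm_apply contDiffOn_snd).sub
      ((contDiffOn_geodesicCovector hU hB).clm_apply h2)).congr fun p _ => ?_
    rw [coordHessian, ← geodesicCovector_apply]
  have hopen : U ×ˢ (univ : Set V) ∈ 𝓝 (y₀, Z₀) := prod_mem_nhds hUn univ_mem
  have sfst : HasStrictFDerivAt (Prod.fst : V × V → V) (ContinuousLinearMap.fst ℝ V V) (y₀, Z₀) :=
    hasStrictFDerivAt_fst
  have ssnd : HasStrictFDerivAt (Prod.snd : V × V → V) (ContinuousLinearMap.snd ℝ V V) (y₀, Z₀) :=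
    hasStrictFDerivAt_snd
  have d0 : HasStrictFDerivAt F (fderiv ℝ F y₀) y₀ :=
    (hF.contDiffAt hUn).hasStrictFDerivAt (by simp)
  have d1 : HasStrictFDerivAt (fderiv ℝ F) (fderiv ℝ (fderiv ℝ F) y₀) y₀ :=
    (hFd.contDiffAt hUn).hasStrictFDerivAt (by simp)
  have dB : HasStrictFDerivAt B (fderiv ℝ B y₀) y₀ :=
    (hB.contDiffAt hUn).hasStrictFDerivAt (by simp)
  have e0 : HasStrictFDerivAt (fun p : V × V => F p.1)
      ((fderiv ℝ F y₀).comp (ContinuousLinearMap.fst ℝ V V)) (y₀, Z₀) :=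
    HasStrictFDerivAt.comp (y₀, Z₀) d0 sfst
  have e1 : HasStrictFDerivAt (fun p : V × V => fderiv ℝ F p.1)
      ((fderiv ℝ (fderiv ℝ F) y₀).comp (ContinuousLinearMap.fst ℝ V V)) (y₀, Z₀) :=
    HasStrictFDerivAt.comp (y₀, Z₀) d1 sfst
  have eB : HasStrictFDerivAt (fun p : V × V => B p.1)
      ((fderiv ℝ B y₀).comp (ContinuousLinearMap.fst ℝ V V)) (y₀, Z₀) :=
    HasStrictFDerivAt.comp (y₀, Z₀) dB sfst
  refine exists_abs_le_mul_norm_of_eq_zero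
    (e0.prodMk ((e1.clm_apply ssnd).prodMk ((eB.clm_apply ssnd).clm_apply ssnd))) ?_
    (by simp [hF0, hF1, hnull])
    ((hKs.contDiffAt hopen).hasStrictFDerivAt (by simp)) ?_
  · set ξ := coordGradient B F y₀
    have hξF : ∀ v, B y₀ ξ v = fderiv ℝ F y₀ v := apply_coordGradient (hb y₀ hy₀)
    set m := fderiv ℝ F y₀ ξ with hm
    have hm0 : m ≠ 0 := by rwa [hm, ← hξF]
    obtain ⟨W, hW⟩ : ∃ W, B y₀ Z₀ W ≠ 0 := by
      by_contra! h
      exact hZ₀ (hb y₀ hy₀ Z₀ h)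
    have hZξ : B y₀ Z₀ ξ = 0 := by rw [hsymm, hξF, hF1]
    rw [eq_top_iff]
    rintro ⟨r₁, r₂, r₃⟩ -
    set δ : V := (r₁ / m) • ξ with hδ
    set W' : V := W - (fderiv ℝ F y₀ W / m) • ξ with hW'
    have hW'0 : fderiv ℝ F y₀ W' = 0 := by
      rw [hW', map_sub, map_smul, smul_eq_mul, ← hm, div_mul_cancel₀ _ hm0, sub_self]
    have hW'1 : B y₀ Z₀ W' = B y₀ Z₀ W := by
      rw [hW', map_sub, map_smul, hZξ, smul_zero, sub_zero]
    -- The linear system is triangular. `δ` fixes the first entry. A multiple of `ξ` then fixes the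
    -- second without affecting the third, as `B(Z₀, ξ) = 0`. A multiple of `W'` fixes the third
    -- without affecting the second, as `dF(W') = 0`.
    refine ⟨(δ, ((r₂ - fderiv ℝ (fderiv ℝ F) y₀ δ Z₀) / m) • ξ +
      ((r₃ - fderiv ℝ B y₀ δ Z₀ Z₀) / (2 * B y₀ Z₀ W)) • W'), ?_⟩
    have hδm : fderiv ℝ F y₀ δ = r₁ := by
      rw [hδ, map_smul, smul_eq_mul, ← hm, div_mul_cancel₀ _ hm0]
    have hs := hsymm y₀
    simp only [ContinuousLinearMap.coe_coe, ContinuousLinearMap.prod_apply,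
      ContinuousLinearMap.comp_apply, ContinuousLinearMap.coe_fst', ContinuousLinearMap.coe_snd',
      add_apply, ContinuousLinearMap.flip_apply, map_add, map_smul, smul_apply, smul_eq_mul,
      hW'0, hδm, ← hm, hZξ, hs ξ Z₀, hs W' Z₀, hW'1, Prod.mk.injEq]
    refine ⟨trivial, ?_, ?_⟩ <;> field_simp <;> ring
  · filter_upwards [hopen] with p hp h
    simp only [Prod.mk_eq_zero] at h
    exact hK p.1 hp.1 p.2 h.1 h.2.1 h.2.2

/-- A null geodesic that is tangent to a level set at one time stays in the level set if the
Hessian vanishes on null vectors that are tangent to the level set. -/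
theorem eventually_mem_level_of_geodesic (hU : IsOpen U) (hB : ContDiffOn ℝ ∞ B U)
    (hb : ∀ y ∈ U, ∀ u, (∀ v, B y u v = 0) → u = 0) (hsymm : ∀ y u v, B y u v = B y v u)
    (hF : ContDiffOn ℝ ∞ F U) {c w a : ℝ → V} {s₀ : ℝ} (hy₀ : c s₀ ∈ U) (hw₀ : w s₀ ≠ 0)
    (hF0 : F (c s₀) = 0) (hF1 : fderiv ℝ F (c s₀) (w s₀) = 0)
    (hξ : B (c s₀) (coordGradient B F (c s₀)) (coordGradient B F (c s₀)) ≠ 0)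
    (hK : ∀ y ∈ U, ∀ Z, F y = 0 → fderiv ℝ F y Z = 0 → B y Z Z = 0 →
      coordHessian B F y Z Z (coordGradient B F y) = 0)
    (hc : ∀ᶠ s in 𝓝 s₀, HasDerivAt c (w s) s) (hw : ∀ᶠ s in 𝓝 s₀, HasDerivAt w (a s) s)
    (hgeo : ∀ᶠ s in 𝓝 s₀, ∀ z, B (c s) (a s) z + christoffelForm B (c s) (w s) (w s) z = 0)
    (hnull : ∀ᶠ s in 𝓝 s₀, B (c s) (w s) (w s) = 0) :
    ∀ᶠ s in 𝓝 s₀, F (c s) = 0 ∧ fderiv ℝ F (c s) (w s) = 0 := by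
  obtain ⟨C, hC⟩ := exists_abs_coordHessian_le hU hB hb hsymm hF hy₀ hw₀ hF0 hF1
    hnull.self_of_nhds hξ hK
  have hcc : ContinuousAt c s₀ := hc.self_of_nhds.continuousAt
  have hwc : ContinuousAt w s₀ := hw.self_of_nhds.continuousAt
  have hcU : ∀ᶠ s in 𝓝 s₀, c s ∈ U := hcc.eventually (hU.mem_nhds hy₀)
  have hCs : ∀ᶠ s in 𝓝 s₀, |coordHessian B F (c s) (w s) (w s) (coordGradient B F (c s))| ≤
        C * ‖(F (c s), fderiv ℝ F (c s) (w s), B (c s) (w s) (w s))‖ :=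
    (hcc.prodMk hwc).eventually hC
  -- Grönwall for the pair `(F, dF(w))`, whose derivative is `(dF(w), Hess(w, w))`. The constant `1`
  -- bounds the first component and `C` the second.
  have key := eventually_eq_zero_of_norm_deriv_le (t₀ := s₀) (K := max 1 C)
    (f := fun s => (F (c s), fderiv ℝ F (c s) (w s)))
    (f' := fun s => (fderiv ℝ F (c s) (w s),
      coordHessian B F (c s) (w s) (w s) (coordGradient B F (c s)))) ?_ ?_
    (by simp [hF0, hF1])
  · filter_upwards [key] with s hs
    simpa using hs
  · filter_upwards [hc, hw, hcU, hgeo] with s hcs hws hUs hgs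
    have hFs : ContDiffAt ℝ ∞ F (c s) := hF.contDiffAt (hU.mem_nhds hUs)
    have h1 := hasDerivAt_fderiv_comp (hFs.of_le two_le_infty) hcs hws
    have h2 : HasDerivAt (fun s => F (c s)) (fderiv ℝ F (c s) (w s)) s :=
      (hFs.differentiableAt (by simp)).hasFDerivAt.comp_hasDerivAt s hcs
    refine h2.prodMk (h1.congr_deriv ?_)
    have h3 := hgs (coordGradient B F (c s))
    rw [hsymm, apply_coordGradient (hb _ hUs)] at h3
    rw [coordHessian]
    linarith
  · filter_upwards [hCs, hnull] with s hs hns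
    have hn : ‖(F (c s), fderiv ℝ F (c s) (w s), B (c s) (w s) (w s))‖ =
        ‖(F (c s), fderiv ℝ F (c s) (w s))‖ := by
      rw [hns]
      simp [Prod.norm_def]
    rw [hn] at hs
    have hnn := norm_nonneg (F (c s), fderiv ℝ F (c s) (w s))
    have hm1 := le_max_left (1 : ℝ) C
    have hm2 := le_max_right (1 : ℝ) C
    rw [Prod.norm_def, max_le_iff]
    constructor
    · calc ‖fderiv ℝ F (c s) (w s)‖ ≤ ‖(F (c s), fderiv ℝ F (c s) (w s))‖ := 
          norm_snd_le (F (c s), fderiv ℝ F (c s) (w s))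
        _ ≤ _ := by nlinarith
    · exact hs.trans (by gcongr)

end LevelSets

/-! ### The Hessian criterion for photon surfaces. -/

section PhotonSurface

set_option maxSynthPendingDepth 3
set_option linter.unusedSectionVars false

variable {V : Type*} [NormedAddCommGroup V] [NormedSpace ℝ V] [FiniteDimensional ℝ V]
  {H : Type*} [TopologicalSpace H] {J : ModelWithCorners ℝ V H} [J.Boundaryless]
  {X : Type*} [TopologicalSpace X] [ChartedSpace H X] [IsManifold J ∞ X]
  {G : MetricField J X} {P U : Set X} {f : X → ℝ}

theorem IsGradient.coordForm_toCoord (hG : IsSmoothMetric G) {q x : X}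
    (hx : x ∈ (chartAt H q).source) (hf : MDifferentiableAt J 𝓘(ℝ, ℝ) f x)
    {ξ : TangentSpace J x} (hξ : IsGradient G f x ξ) (v : V) :
    hG.coordForm q (extChartAt J q x) (toCoord q x ξ) v =
      fderiv ℝ (f ∘ (extChartAt J q).symm) (extChartAt J q x) v := by
  rw [← mvfderiv_ofCoord hx hf, ← hξ]
  conv_lhs => rw [← toCoord_ofCoord (J := J) hx v]
  rw [hG.coordForm_toCoord hx]

/-- Inside `U` the set `P` is relatively closed, being a zero set. Short geodesics within `U` thus
satisfy the edge condition. -/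
theorem IsDefiningFunction.not_mem_edge (hf : IsDefiningFunction J P U f) {x : X} (hx : x ∈ U) :
    x ∉ closure P \ P := by
  rintro ⟨hxc, hxP⟩
  apply hxP
  rw [hf.mem_iff hx]
  by_contra h0
  have h1 : ∀ᶠ z in 𝓝 x, f z ≠ 0 ∧ z ∈ U :=
    ((hf.contMDiffAt hx).continuousAt.eventually_ne h0).and (hf.isOpen.eventually_mem hx)
  obtain ⟨z, hz, hzP⟩ := (mem_closure_iff_frequently.1 hxc).and_eventually h1 |>.exists
  exact hzP.1 ((hf.mem_iff hzP.2).1 hz)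

theorem contDiffAt_deriv {E : Type*} [NormedAddCommGroup E] [NormedSpace ℝ E] {c : ℝ → E} {s : ℝ}
    (hc : ContDiffAt ℝ 2 c s) : ContDiffAt ℝ 1 (deriv c) s :=
  (hc.fderiv_right (m := 1) (by norm_num)).clm_apply (contDiffAt_const (c := (1 : ℝ)))

theorem deriv_comp_curve {γ : ℝ → X} {s : ℝ} (hf : MDifferentiableAt J 𝓘(ℝ, ℝ) f (γ s))
    (hγ : MDifferentiableAt 𝓘(ℝ, ℝ) J γ s) :
    deriv (f ∘ γ) s = mvfderiv J f (γ s) (velocity J γ s) := by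
  rw [← fderiv_apply_one_eq_deriv, ← mfderiv_eq_fderiv, mfderiv_comp s hf hγ]
  rfl

/-- On a photon surface, the Hessian of a defining function vanishes on tangent null vectors. -/
theorem IsPhotonSurface.hessianAt_eq_zero (hG : IsSmoothMetric G) (hP : IsPhotonSurface G P)
    (hf : IsDefiningFunction J P U f) {p : X} (hp : p ∈ P) (hpU : p ∈ U) {ξ : TangentSpace J p}
    (hξ : IsGradient G f p ξ) {Z : TangentSpace J p} (hZ : Z ∈ tangentSpaceOf J P p)
    (hZ0 : Z ≠ 0) (hnull : G p Z Z = 0) : hessianAt hG p f p ξ Z Z = 0 := by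
  have hps : p ∈ (chartAt H p).source := mem_chart_source H p
  have hpe : p ∈ (extChartAt J p).source := by rwa [extChartAt_source]
  set φ := extChartAt J p with hφ
  have ht : φ p ∈ φ.target := φ.map_source hpe
  set F : V → ℝ := f ∘ φ.symm with hF
  set B := hG.coordForm p with hB
  have hOo : IsOpen (φ.target ∩ φ.symm ⁻¹' U) :=
    (continuousOn_extChartAt_symm p).isOpen_inter_preimage (isOpen_extChartAt_target p) hf.isOpen
  obtain ⟨ε, hε, c, w, a, hc0, hw0, hode, hc2⟩ := exists_geodesic_coord hOo
    ((hG.contDiffOn_coordForm p).mono inter_subset_left)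
    (fun y hy => hG.coordForm_nondegenerate hy.1) (y := φ p)
    ⟨ht, by rw [mem_preimage, φ.left_inv hpe]; exact hpU⟩ (toCoord p p Z)
  have hw0' : w 0 ≠ 0 := by
    rw [hw0]
    intro h
    exact hZ0 (by rw [← ofCoord_toCoord hps Z, h, map_zero])
  have h0 : (0 : ℝ) ∈ Ioo (-ε) ε := by simp [hε]
  obtain ⟨δ, hδ, hwδ⟩ := Metric.eventually_nhds_iff.1
    ((hode 0 h0).2.2.1.continuousAt.eventually_ne hw0')
  -- The interval is shortened so that the velocity stays nonzero, as a null geodesic requires.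
  set T := Ioo (-min ε δ) (min ε δ) with hT
  have hTε : T ⊆ Ioo (-ε) ε :=
    Ioo_subset_Ioo (neg_le_neg (min_le_left _ _)) (min_le_left _ _)
  have hwT : ∀ s ∈ T, w s ≠ 0 := by
    intro s hs
    refine hwδ ?_
    have := min_le_right ε δ
    rw [Real.dist_eq, sub_zero, abs_lt]
    exact ⟨by linarith [hs.1], by linarith [hs.2]⟩
  have h0T : (0 : ℝ) ∈ T := by simp [hT, hε, hδ]
  let γ : ℝ → X := fun s => φ.symm (c s)
  have hφγ : ∀ s ∈ T, φ (γ s) = c s := fun s hs => φ.right_inv (hode s (hTε hs)).1.1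
  have hγs : ∀ s ∈ T, γ s ∈ (chartAt H p).source := fun s hs =>
    extChartAt_symm_mem_source (hode s (hTε hs)).1.1
  have hγU : ∀ s ∈ T, γ s ∈ U := fun s hs => (hode s (hTε hs)).1.2
  have hγ2 : ContMDiffOn 𝓘(ℝ, ℝ) J 2 γ T :=
    ((contMDiffOn_extChartAt_symm (n := ∞) p).of_le two_le_infty).comp
      (hc2.mono hTε).contMDiffOn fun s hs => (hode s (hTε hs)).1.1
  have hγd : ∀ s ∈ T, MDifferentiableAt 𝓘(ℝ, ℝ) J γ s := fun s hs =>
    (hγ2.contMDiffAt (isOpen_Ioo.mem_nhds hs)).mdifferentiableAt (by simp)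
  have hcoord : ∀ s ∈ T, (fun s => φ (γ s)) =ᶠ[𝓝 s] c := fun s hs => by
    filter_upwards [isOpen_Ioo.mem_nhds hs] with s' hs' using hφγ s' hs'
  have hd1 : ∀ s ∈ T, deriv (fun s => φ (γ s)) s = w s := fun s hs => by
    rw [(hcoord s hs).deriv_eq, (hode s (hTε hs)).2.1.deriv]
  have hd2 : ∀ s ∈ T, deriv (deriv (fun s => φ (γ s))) s = a s := fun s hs => by
    have : deriv (fun s => φ (γ s)) =ᶠ[𝓝 s] w := by
      filter_upwards [isOpen_Ioo.mem_nhds hs] with s' hs' using hd1 s' hs'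
    rw [this.deriv_eq, (hode s (hTε hs)).2.2.1.deriv]
  have hvel : ∀ s ∈ T, toCoord p (γ s) (velocity J γ s) = w s := fun s hs => by
    rw [toCoord_velocity (hγs s hs) (hγd s hs), hd1 s hs]
  have hconst : ∀ s ∈ T, B (c s) (w s) (w s) = 0 := by
    have hder : ∀ s ∈ T, HasDerivAt (fun s => B (c s) (w s) (w s)) 0 s := fun s hs => by
      obtain ⟨h1, h2, h3, h4⟩ := hode s (hTε hs)
      exact hasDerivAt_metric_velocity (hG.differentiableAt_coordForm h1.1)
        (hG.coordForm_symm p _) h2 h3 (h4 _)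
    intro s hs
    have := isOpen_Ioo.is_const_of_deriv_eq_zero isPreconnected_Ioo
      (fun s hs => (hder s hs).differentiableAt.differentiableWithinAt)
      (fun s hs => (hder s hs).deriv) hs h0T
    rw [this, hc0, hw0, hB, hG.coordForm_toCoord hps, hnull]
  have hgeod : IsNullGeodesicOn G γ T := by
    refine ⟨⟨hγ2, fun s₀ hs₀ => ⟨p, hγs s₀ hs₀, ?_⟩⟩, fun s hs => ⟨fun h => ?_, ?_⟩⟩
    · change ∀ᶠ s in 𝓝 s₀, ∀ z : V, coordMetric G p (φ (γ s)) _ z + christoffel G p (φ (γ s)) _ _ z = 0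
      filter_upwards [isOpen_Ioo.mem_nhds hs₀] with s hs z
      obtain ⟨h1, h2, h3, h4⟩ := hode s (hTε hs)
      rw [hd1 s hs, hd2 s hs, hφγ s hs, hG.christoffel_eq h1.1]
      exact h4 z
    · apply hwT s hs
      rw [← hvel s hs, h, map_zero]
    · rw [← hG.coordForm_toCoord (hγs s hs), hvel s hs, hφγ s hs]
      exact hconst s hs
  have hγ0 : γ 0 = p := by
    change φ.symm (c 0) = p
    rw [hc0, φ.left_inv hpe]
  have hγ0P : γ 0 ∈ P := by rwa [hγ0]
  have hstay := hP.2 γ T isOpen_Ioo ordConnected_Ioo hgeod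
    (fun s hs => hf.not_mem_edge (hγU s hs)) 0 h0T hγ0P (by
      rw [hf.mem_tangentSpaceOf_iff hγ0P (hγU 0 h0T),
        mvfderiv_eq_fderiv_toCoord (hγs 0 h0T) (hf.mdifferentiableAt (hγU 0 h0T)), hvel 0 h0T,
        hφγ 0 h0T, hc0, hw0, ← mvfderiv_eq_fderiv_toCoord hps (hf.mdifferentiableAt hpU)]
      exact (hf.mem_tangentSpaceOf_iff hp hpU).1 hZ)
  have hFw : ∀ s ∈ T, fderiv ℝ F (c s) (w s) = 0 := fun s hs => by
    obtain ⟨h1, h2⟩ := hstay s hs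
    rw [hf.mem_tangentSpaceOf_iff h1 (hγU s hs), mvfderiv_eq_fderiv_toCoord (hγs s hs)
      (hf.mdifferentiableAt (hγU s hs)), hvel s hs, hφγ s hs] at h2
    exact h2
  have hder := hasDerivAt_fderiv_comp (f := F) (s := 0) (c := c) (w := w) (a := a 0)
    (by
      rw [hc0]
      exact (hf.contDiffAt_coord hpU hps).of_le two_le_infty)
    (hode 0 h0).2.1 (hode 0 h0).2.2.1
  have hder0 : HasDerivAt (fun s => fderiv ℝ F (c s) (w s)) 0 0 := by
    refine (hasDerivAt_const (0 : ℝ) (0 : ℝ)).congr_of_eventuallyEq ?_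
    filter_upwards [isOpen_Ioo.mem_nhds h0T] with s hs using hFw s hs
  -- The geodesic remains tangent to `P`, so `dF(w)` is identically zero and its derivative `D²F(Z,
  -- Z) + dF(a)` vanishes at `0`. The geodesic equation tested against `ξ` replaces `dF(a)` by
  -- `-Γ(Z, Z, ξ)`.
  have h1 := hder.unique hder0
  have h2 := (hode 0 h0).2.2.2 (toCoord p p ξ)
  rw [hc0, hw0] at h1 h2
  rw [hG.coordForm_symm, hξ.coordForm_toCoord hG hps (hf.mdifferentiableAt hpU)] at h2
  rw [hessianAt, coordHessian]
  linarith

/-- A timelike hypersurface is a photon surface if the Hessian of local defining functions vanishes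
on tangent null vectors. -/
theorem isPhotonSurface_of_hessianAt_eq_zero (hG : IsSmoothMetric G)
    (hP : IsTimelikeHypersurface G P)
    (h : ∀ p ∈ P, ∃ U f, p ∈ U ∧ IsDefiningFunction J P U f ∧
      ∀ x ∈ P, x ∈ U → ∀ ξ, IsGradient G f x ξ → G x ξ ξ ≠ 0 ∧
        ∀ Z ∈ tangentSpaceOf J P x, G x Z Z = 0 → hessianAt hG x f x ξ Z Z = 0) :
    IsPhotonSurface G P := by
  refine ⟨hP, fun γ T hTo hTc hγ hedge s₀ hs₀ hs₀P hs₀v => ?_⟩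
  have hγ2 : ∀ s ∈ T, ContMDiffAt 𝓘(ℝ, ℝ) J 2 γ s := fun s hs =>
    hγ.1.1.contMDiffAt (hTo.mem_nhds hs)
  have hγd : ∀ s ∈ T, MDifferentiableAt 𝓘(ℝ, ℝ) J γ s := fun s hs =>
    (hγ2 s hs).mdifferentiableAt (by simp)
  let A : Set ℝ := {s | s ∈ T ∧ γ s ∈ P ∧ velocity J γ s ∈ tangentSpaceOf J P (γ s)}
  suffices hsub : T ⊆ A from fun s hs => (hsub hs).2
  -- The good parameters form an open and relatively closed subset of the interval `T`: open by the
  -- local Grönwall argument, closed because the geodesic avoids the edge.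
  refine hTc.isPreconnected.subset_of_closure_inter_subset ?_ ⟨s₀, hs₀, hs₀, hs₀P, hs₀v⟩ ?_
  · rw [isOpen_iff_mem_nhds]
    rintro s₁ ⟨hs₁, hs₁P, hs₁v⟩
    obtain ⟨U, f, hpU, hf, hx⟩ := h _ hs₁P
    obtain ⟨q, hq, hgeo⟩ := hγ.1.2 s₁ hs₁
    set φ := extChartAt J q with hφ
    set F : V → ℝ := f ∘ φ.symm with hF
    set B := hG.coordForm q with hB
    set O := φ.target ∩ φ.symm ⁻¹' U with hO
    have hOo : IsOpen O :=
      (continuousOn_extChartAt_symm q).isOpen_inter_preimage (isOpen_extChartAt_target q) hf.isOpen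
    set c : ℝ → V := fun s => φ (γ s) with hc
    have hev : ∀ᶠ s in 𝓝 s₁, s ∈ T ∧ γ s ∈ U ∧ γ s ∈ (chartAt H q).source :=
      (hTo.eventually_mem hs₁).and (((hγ2 s₁ hs₁).continuousAt.eventually
        (hf.isOpen.mem_nhds hpU)).and ((hγ2 s₁ hs₁).continuousAt.eventually
          ((chartAt H q).open_source.mem_nhds hq)))
    have hsrc : ∀ {x}, x ∈ (chartAt H q).source → x ∈ φ.source := fun hx => by
      rwa [hφ, extChartAt_source]
    have hmemO : ∀ {x}, x ∈ U → x ∈ (chartAt H q).source → φ x ∈ O := fun hxU hxq =>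
      ⟨φ.map_source (hsrc hxq), by rw [mem_preimage, φ.left_inv (hsrc hxq)]; exact hxU⟩
    have hc2 : ∀ s, s ∈ T → γ s ∈ (chartAt H q).source → ContDiffAt ℝ 2 c s := fun s hs hsq => by
      rw [← contMDiffAt_iff_contDiffAt]
      exact (contMDiffAt_extChartAt' (n := 2) (I := J) hsq).comp s (hγ2 s hs)
    have hvel : ∀ s, s ∈ T → γ s ∈ (chartAt H q).source →
        toCoord q (γ s) (velocity J γ s) = deriv c s := fun s hs hsq =>
      toCoord_velocity hsq (hγd s hs)
    have hmem : ∀ s, s ∈ T → γ s ∈ U → γ s ∈ (chartAt H q).source →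
        ((γ s ∈ P ∧ velocity J γ s ∈ tangentSpaceOf J P (γ s)) ↔
          (F (c s) = 0 ∧ fderiv ℝ F (c s) (deriv c s) = 0)) := fun s hs hsU hsq => by
      have h1 : F (c s) = f (γ s) := by
        change f (φ.symm (φ (γ s))) = _
        rw [φ.left_inv (hsrc hsq)]
      rw [h1, ← hf.mem_iff hsU, ← hvel s hs hsq,
        ← mvfderiv_eq_fderiv_toCoord hsq (hf.mdifferentiableAt hsU)]
      exact and_congr_right fun hsP => hf.mem_tangentSpaceOf_iff hsP hsU
    have hFO : ContDiffOn ℝ ∞ F O := fun y hy => by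
      have := hf.contDiffAt_coord hy.2 (extChartAt_symm_mem_source hy.1)
      rw [(extChartAt J q).right_inv hy.1] at this
      exact this.contDiffWithinAt
    have hgrad : ∀ y ∈ O, IsGradient G f (φ.symm y) (ofCoord q _ (coordGradient B F y)) :=
      fun y hy v => by
        have hyq := extChartAt_symm_mem_source (J := J) hy.1
        have hr : φ (φ.symm y) = y := φ.right_inv hy.1
        rw [← hG.coordForm_toCoord hyq, toCoord_ofCoord hyq,
          mvfderiv_eq_fderiv_toCoord hyq (hf.mdifferentiableAt hy.2), ← hφ, hr]
        exact apply_coordGradient (hG.coordForm_nondegenerate hy.1) _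
    have h01 := (hmem s₁ hs₁ hpU hq).1 ⟨hs₁P, hs₁v⟩
    have hGv : ∀ y ∈ O, ∀ u v : V, G (φ.symm y) (ofCoord q _ u) (ofCoord q _ v) = B y u v :=
      fun y hy u v => rfl
    have key := eventually_mem_level_of_geodesic (c := c) (w := deriv c) (a := deriv (deriv c))
      hOo ((hG.contDiffOn_coordForm q).mono inter_subset_left)
      (fun y hy => hG.coordForm_nondegenerate hy.1) (hG.coordForm_symm q) hFO
      (hmemO hpU hq) ?_ h01.1 h01.2 ?_ ?_ ?_ ?_ ?_ ?_
    · filter_upwards [key, hev] with s hs hs'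
      exact ⟨hs'.1, (hmem s hs'.1 hs'.2.1 hs'.2.2).2 hs⟩
    · rw [← hvel s₁ hs₁ hq]
      intro h0
      apply (hγ.2 s₁ hs₁).1
      rw [← ofCoord_toCoord hq (velocity J γ s₁), h0, map_zero]
    · have hy := hmemO hpU hq
      have hyP : φ.symm (c s₁) ∈ P := by
        change φ.symm (φ (γ s₁)) ∈ P
        rwa [φ.left_inv (hsrc hq)]
      have := (hx _ hyP hy.2 _ (hgrad _ hy)).1
      rwa [hGv _ hy] at this
    · intro y hy Z h0 h1 h2
      have hyq := extChartAt_symm_mem_source (J := J) hy.1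
      have hr : φ (φ.symm y) = y := φ.right_inv hy.1
      have hyP : φ.symm y ∈ P := (hf.mem_iff hy.2).2 h0
      have hZ : ofCoord q _ Z ∈ tangentSpaceOf J P (φ.symm y) := by
        rw [hf.mem_tangentSpaceOf_iff hyP hy.2,
          mvfderiv_ofCoord hyq (hf.mdifferentiableAt hy.2), ← hφ, hr]
        exact h1
      have h3 := (hx _ hyP hy.2 _ (hgrad _ hy)).2 _ hZ (by rw [hGv y hy]; exact h2)
      -- The hypothesis uses the chart around the point itself, whereas the geodesic equation holds
      -- in the chart around `q`; invariance of the Hessian mediates.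
      rw [hessianAt_eq hG (mem_chart_source H _) hyq (hf.contMDiffAt hy.2) (hgrad y hy),
        hessianAt, toCoord_ofCoord hyq, toCoord_ofCoord hyq, ← hφ, hr] at h3
      exact h3
    · filter_upwards [hev] with s hs
      exact ((hc2 s hs.1 hs.2.2).differentiableAt (by simp)).hasDerivAt
    · filter_upwards [hev] with s hs
      have h1 : ContDiffAt ℝ 1 (deriv c) s := contDiffAt_deriv (hc2 s hs.1 hs.2.2)
      exact (h1.differentiableAt (by simp)).hasDerivAt
    · filter_upwards [hgeo, hev] with s hs hs' z
      have := hs z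
      rw [hG.christoffel_eq (hmemO hs'.2.1 hs'.2.2).1] at this
      exact this
    · filter_upwards [hev] with s hs
      rw [← hvel s hs.1 hs.2.2]
      change hG.coordForm q (φ (γ s)) _ _ = 0
      rw [hG.coordForm_toCoord hs.2.2]
      exact (hγ.2 s hs.1).2
  · rintro s₁ ⟨hs₁c, hs₁⟩
    have hγc : ContinuousAt γ s₁ := (hγ2 s₁ hs₁).continuousAt
    have hcl : γ s₁ ∈ closure P :=
      closure_mono (by rintro _ ⟨s, hs, rfl⟩; exact hs.2.1)
        (hγc.continuousWithinAt.mem_closure_image hs₁c)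
    have hs₁P : γ s₁ ∈ P := by
      by_contra hn
      exact hedge s₁ hs₁ ⟨hcl, hn⟩
    refine ⟨hs₁, hs₁P, ?_⟩
    obtain ⟨U, f, hpU, hf, -⟩ := h _ hs₁P
    rw [hf.mem_tangentSpaceOf_iff hs₁P hpU]
    have hev : ∀ᶠ s in 𝓝 s₁, γ s ∈ U := hγc.eventually (hf.isOpen.mem_nhds hpU)
    have hfreq : ∃ᶠ s in 𝓝 s₁, s ∈ A := mem_closure_iff_frequently.1 hs₁c
    have hfγ : ContDiffAt ℝ 2 (f ∘ γ) s₁ := by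
      rw [← contMDiffAt_iff_contDiffAt]
      exact ((hf.contMDiffAt hpU).of_le two_le_infty).comp s₁ (hγ2 s₁ hs₁)
    rw [← deriv_comp_curve (hf.mdifferentiableAt hpU) (hγd s₁ hs₁)]
    -- Tangency is a closed condition: `(f ∘ γ)'` is continuous and vanishes at good parameters
    -- arbitrarily close to `s₁`.
    by_contra hne
    have hne' := (contDiffAt_deriv hfγ).continuousAt.eventually_ne hne
    obtain ⟨s, hsA, hsU, hs⟩ := (hfreq.and_eventually (hev.and hne')).exists
    apply hs
    rw [deriv_comp_curve (hf.mdifferentiableAt hsU) (hγd s hsA.1)]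
    exact (hf.mem_tangentSpaceOf_iff hsA.2.1 hsU).1 hsA.2.2

end PhotonSurface

/-! ### Smoothness of a Riemannian metric in charts. -/

section Riemannian

set_option maxSynthPendingDepth 3
set_option linter.unusedSectionVars false

variable {n : ℕ} {M : Type*} [TopologicalSpace M] [ChartedSpace (EuclideanSpace ℝ (Fin n)) M]
  [IsManifold (𝓡 n) ∞ M]

theorem contMDiffAt_ofCoord {V : Type*} [NormedAddCommGroup V] [NormedSpace ℝ V]
    {H : Type*} [TopologicalSpace H] {J : ModelWithCorners ℝ V H} [J.Boundaryless]
    {X : Type*} [TopologicalSpace X] [ChartedSpace H X] [IsManifold J ∞ X] {q x : X}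
    (hx : x ∈ (chartAt H q).source) (u : V) :
    ContMDiffAt J J.tangent ∞ (fun x => (⟨x, ofCoord q x u⟩ : TangentBundle J X)) x := by
  have hsrc : ∀ x, x ∈ (chartAt H q).source →
      x ∈ (trivializationAt V (TangentSpace J : X → Type _) q).baseSet := fun x hx => by
    simpa using hx
  rw [Trivialization.contMDiffAt_section_iff _ (hsrc x hx)]
  refine (contMDiffAt_const (c := u)).congr_of_eventuallyEq ?_
  filter_upwards [(chartAt H q).open_source.eventually_mem hx] with x hx
  have h2 := toCoord_ofCoord (J := J) hx u
  rwa [toCoord, Trivialization.continuousLinearMapAt_apply, Trivialization.linearMapAt_apply,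
    if_pos (hsrc x hx)] at h2

theorem isSmoothMetric_metricField
    (g : ContMDiffRiemannianMetric (𝓡 n) ∞ (EuclideanSpace ℝ (Fin n))
      (fun x : M => TangentSpace (𝓡 n) x)) : IsSmoothMetric (metricField g) where
  add_left p u u' v := by simp [metricField]
  smul_left p c u v := by simp [metricField]
  symm p u v := g.symm p u v
  nondegenerate p u hu := by
    by_contra h
    exact (g.pos p u h).ne' (hu u)
  smooth q u v := by
    intro y hy
    have hx := extChartAt_symm_mem_source hy
    have h1 := ContMDiffAt.clm_bundle_apply₂ (F₁ := EuclideanSpace ℝ (Fin n))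
      (F₂ := EuclideanSpace ℝ (Fin n)) (F₃ := ℝ) (E₃ := fun _ : M => ℝ) (b := id)
      (g.contMDiff ((extChartAt (𝓡 n) q).symm y))
      (contMDiffAt_ofCoord hx u) (contMDiffAt_ofCoord hx v)
    have h2 := (contMDiffAt_totalSpace.1 h1).2
    have h3 : ContMDiffAt (𝓡 n) 𝓘(ℝ, ℝ) ∞
        (fun x => g.inner x (ofCoord q x u) (ofCoord q x v)) ((extChartAt (𝓡 n) q).symm y) := h2
    have h4 := h3.comp y ((contMDiffOn_extChartAt_symm (n := ∞) q).contMDiffAt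
      ((isOpen_extChartAt_target q).mem_nhds hy))
    exact (contMDiffAt_iff_contDiffAt.1 h4).contDiffWithinAt

theorem metricField_self_nonneg
    (g : ContMDiffRiemannianMetric (𝓡 n) ∞ (EuclideanSpace ℝ (Fin n))
      (fun x : M => TangentSpace (𝓡 n) x)) (x : M) (u : TangentSpace (𝓡 n) x) :
    0 ≤ metricField g x u u := by
  by_cases h : u = 0
  · simp [h, metricField]
  · exact (g.pos x u h).le

end Riemannian

/-! ### The static metric: product charts, gradients and Hessians. -/

section Static

set_option maxSynthPendingDepth 3
set_option linter.unusedSectionVars false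

variable {n : ℕ} {M : Type*} [TopologicalSpace M] [ChartedSpace (EuclideanSpace ℝ (Fin n)) M]
  [IsManifold (𝓡 n) ∞ M]

/-- The time component of a tangent vector of `ℝ × M`. -/
def timeComp (p : ℝ × M) : TangentSpace (𝓘(ℝ, ℝ).prod (𝓡 n)) p →L[ℝ] ℝ :=
  mvfderiv (𝓘(ℝ, ℝ).prod (𝓡 n)) (Prod.fst : ℝ × M → ℝ) p

/-- The spatial component of a tangent vector of `ℝ × M`. -/
def spaceComp (p : ℝ × M) :
    TangentSpace (𝓘(ℝ, ℝ).prod (𝓡 n)) p →L[ℝ] TangentSpace (𝓡 n) p.2 :=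
  mfderiv (𝓘(ℝ, ℝ).prod (𝓡 n)) (𝓡 n) (Prod.snd : ℝ × M → M) p

theorem staticMetric_apply (g : MetricField (𝓡 n) M) (N : M → ℝ) (p : ℝ × M)
    (u v : TangentSpace (𝓘(ℝ, ℝ).prod (𝓡 n)) p) :
    staticMetric g N p u v = g p.2 (spaceComp p u) (spaceComp p v)
      - N p.2 ^ 2 * (timeComp p u * timeComp p v) := rfl

theorem extChartAt_prod_symm_apply (q : ℝ × M) (z : ℝ × EuclideanSpace ℝ (Fin n)) :
    (extChartAt (𝓘(ℝ, ℝ).prod (𝓡 n)) q).symm z = (z.1, (extChartAt (𝓡 n) q.2).symm z.2) := by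
  rw [extChartAt_prod]
  simp [chartAt_self_eq]

theorem extChartAt_prod_apply (q p : ℝ × M) :
    extChartAt (𝓘(ℝ, ℝ).prod (𝓡 n)) q p = (p.1, extChartAt (𝓡 n) q.2 p.2) := by
  rw [extChartAt_prod]
  simp [chartAt_self_eq]

theorem mem_extChartAt_prod_target {q : ℝ × M} {z : ℝ × EuclideanSpace ℝ (Fin n)} :
    z ∈ (extChartAt (𝓘(ℝ, ℝ).prod (𝓡 n)) q).target ↔ z.2 ∈ (extChartAt (𝓡 n) q.2).target := by
  rw [extChartAt_prod]
  simp [PartialEquiv.prod_target, chartAt_self_eq]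

theorem mem_chartAt_prod_source {q p : ℝ × M} :
    p ∈ (chartAt (ModelProd ℝ (EuclideanSpace ℝ (Fin n))) q).source ↔
      p.2 ∈ (chartAt (EuclideanSpace ℝ (Fin n)) q.2).source := by
  rw [prodChartedSpace_chartAt]
  simp [chartAt_self_eq]

theorem toCoord_fst {q p : ℝ × M} (hp : p.2 ∈ (chartAt (EuclideanSpace ℝ (Fin n)) q.2).source)
    (u : TangentSpace (𝓘(ℝ, ℝ).prod (𝓡 n)) p) : (toCoord q p u).1 = timeComp p u := by
  have hp' := mem_chartAt_prod_source.2 hp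
  have hφ : MDifferentiableAt (𝓘(ℝ, ℝ).prod (𝓡 n)) 𝓘(ℝ, ℝ × EuclideanSpace ℝ (Fin n))
      (extChartAt (𝓘(ℝ, ℝ).prod (𝓡 n)) q) p := mdifferentiableAt_extChartAt hp'
  have h1 : (Prod.fst ∘ extChartAt (𝓘(ℝ, ℝ).prod (𝓡 n)) q) = (Prod.fst : ℝ × M → ℝ) := by
    funext z
    exact congrArg Prod.fst (extChartAt_prod_apply q z)
  have h2 := mfderiv_comp (I' := 𝓘(ℝ, ℝ × EuclideanSpace ℝ (Fin n))) (I'' := 𝓘(ℝ, ℝ)) p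
    (differentiableAt_fst (𝕜 := ℝ)).mdifferentiableAt hφ
  rw [h1, mfderiv_eq_fderiv, fderiv_fst] at h2
  rw [toCoord_eq_mvfderiv hp']
  exact (congrArg (fun l => l u) h2).symm

theorem toCoord_snd {q p : ℝ × M} (hp : p.2 ∈ (chartAt (EuclideanSpace ℝ (Fin n)) q.2).source)
    (u : TangentSpace (𝓘(ℝ, ℝ).prod (𝓡 n)) p) :
    (toCoord q p u).2 = toCoord q.2 p.2 (spaceComp p u) := by
  have hp' := mem_chartAt_prod_source.2 hp
  have hφ : MDifferentiableAt (𝓘(ℝ, ℝ).prod (𝓡 n)) 𝓘(ℝ, ℝ × EuclideanSpace ℝ (Fin n))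
      (extChartAt (𝓘(ℝ, ℝ).prod (𝓡 n)) q) p := mdifferentiableAt_extChartAt hp'
  have h1 : (Prod.snd ∘ extChartAt (𝓘(ℝ, ℝ).prod (𝓡 n)) q) =
      extChartAt (𝓡 n) q.2 ∘ (Prod.snd : ℝ × M → M) := by
    funext z
    exact congrArg Prod.snd (extChartAt_prod_apply q z)
  have h2 := mfderiv_comp (I' := 𝓘(ℝ, ℝ × EuclideanSpace ℝ (Fin n)))
    (I'' := 𝓘(ℝ, EuclideanSpace ℝ (Fin n))) p
    (differentiableAt_snd (𝕜 := ℝ)).mdifferentiableAt hφ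
  have h3 := mfderiv_comp (I := 𝓘(ℝ, ℝ).prod (𝓡 n)) (I' := 𝓡 n)
    (I'' := 𝓘(ℝ, EuclideanSpace ℝ (Fin n))) p
    (mdifferentiableAt_extChartAt (I := 𝓡 n) hp) mdifferentiableAt_snd
  rw [h1, mfderiv_eq_fderiv, fderiv_snd, h3] at h2
  rw [toCoord_eq_mvfderiv hp', toCoord_eq_mvfderiv hp]
  exact (congrArg (fun l => l u) h2).symm

/-- The tangent vector of `ℝ × M` with given components. -/
def liftVector (p : ℝ × M) (a : ℝ) (Y : TangentSpace (𝓡 n) p.2) :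
    TangentSpace (𝓘(ℝ, ℝ).prod (𝓡 n)) p :=
  ofCoord p p ((a, toCoord p.2 p.2 Y) : ℝ × EuclideanSpace ℝ (Fin n))

theorem timeComp_liftVector (p : ℝ × M) (a : ℝ) (Y : TangentSpace (𝓡 n) p.2) :
    timeComp p (liftVector p a Y) = a := by
  rw [← toCoord_fst (mem_chart_source _ p.2), liftVector, toCoord_ofCoord (mem_chart_source _ p)]

theorem spaceComp_liftVector (p : ℝ × M) (a : ℝ) (Y : TangentSpace (𝓡 n) p.2) :
    spaceComp p (liftVector p a Y) = Y := by
  have hp := mem_chart_source (EuclideanSpace ℝ (Fin n)) p.2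
  rw [← ofCoord_toCoord hp (spaceComp p (liftVector p a Y)), ← toCoord_snd hp, liftVector,
    toCoord_ofCoord (mem_chart_source _ p), ofCoord_toCoord hp]

theorem eq_zero_of_comp_eq_zero {p : ℝ × M} {u : TangentSpace (𝓘(ℝ, ℝ).prod (𝓡 n)) p}
    (h1 : timeComp p u = 0) (h2 : spaceComp p u = 0) : u = 0 := by
  have hp := mem_chart_source (EuclideanSpace ℝ (Fin n)) p.2
  have h : toCoord p p u = 0 :=
    Prod.ext (by rw [toCoord_fst hp, h1]; rfl) (by rw [toCoord_snd hp, h2, map_zero]; rfl)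
  rw [← ofCoord_toCoord (mem_chart_source _ p) u, h, map_zero]

variable {g : MetricField (𝓡 n) M} {N : M → ℝ}

theorem coordMetric_staticMetric (hg : IsSmoothMetric g) {q : ℝ × M}
    {z : ℝ × EuclideanSpace ℝ (Fin n)} (hz : z.2 ∈ (extChartAt (𝓡 n) q.2).target)
    (u v : ℝ × EuclideanSpace ℝ (Fin n)) :
    coordMetric (staticMetric g N) q z u v = hg.coordForm q.2 z.2 u.2 v.2
      - N ((extChartAt (𝓡 n) q.2).symm z.2) ^ 2 * (u.1 * v.1) := by
  have hz' := mem_extChartAt_prod_target.2 hz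
  have hps := extChartAt_symm_mem_source hz'
  have h2 : ((extChartAt (𝓘(ℝ, ℝ).prod (𝓡 n)) q).symm z).2 = (extChartAt (𝓡 n) q.2).symm z.2 :=
    congrArg Prod.snd (extChartAt_prod_symm_apply q z)
  have hr : extChartAt (𝓡 n) q.2 ((extChartAt (𝓘(ℝ, ℝ).prod (𝓡 n)) q).symm z).2 = z.2 := by
    rw [h2, (extChartAt (𝓡 n) q.2).right_inv hz]
  rw [coordMetric, staticMetric_apply, ← h2]
  generalize (extChartAt (𝓘(ℝ, ℝ).prod (𝓡 n)) q).symm z = p at *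
  have hp := mem_chartAt_prod_source.1 hps
  rw [← toCoord_fst hp, ← toCoord_fst hp, ← hg.coordForm_toCoord hp, ← toCoord_snd hp,
    ← toCoord_snd hp, toCoord_ofCoord hps, toCoord_ofCoord hps, hr]

theorem isSmoothMetric_staticMetric (hg : IsSmoothMetric g) (hN : ContMDiff (𝓡 n) 𝓘(ℝ, ℝ) ∞ N)
    (hNpos : ∀ x, 0 < N x) : IsSmoothMetric (staticMetric g N) where
  add_left p u u' v := by
    simp only [staticMetric_apply, map_add, hg.add_left]
    ring
  smul_left p c u v := by
    simp only [staticMetric_apply, map_smul, hg.smul_left, smul_eq_mul]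
    ring
  symm p u v := by
    simp only [staticMetric_apply, hg.symm p.2 (spaceComp p u), mul_comm (timeComp p u)]
  nondegenerate p u hu := by
    have hg0 : ∀ v, g p.2 v 0 = 0 := fun v => by
      simpa using hg.smul_right p.2 0 v 0
    refine eq_zero_of_comp_eq_zero ?_ (hg.nondegenerate _ _ fun Y => ?_)
    · have := hu (liftVector p 1 0)
      rw [staticMetric_apply, timeComp_liftVector, spaceComp_liftVector, hg0] at this
      simpa [(hNpos p.2).ne'] using this
    · have := hu (liftVector p 0 Y)
      rw [staticMetric_apply, timeComp_liftVector, spaceComp_liftVector] at this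
      simpa using this
  smooth q u v := by
    have h1 : ContDiffOn ℝ ∞ (fun z : ℝ × EuclideanSpace ℝ (Fin n) =>
        hg.coordForm q.2 z.2 u.2 v.2
          - N ((extChartAt (𝓡 n) q.2).symm z.2) ^ 2 * (u.1 * v.1))
        (extChartAt (𝓘(ℝ, ℝ).prod (𝓡 n)) q).target := by
      have hmaps : MapsTo (Prod.snd : ℝ × EuclideanSpace ℝ (Fin n) → _)
          (extChartAt (𝓘(ℝ, ℝ).prod (𝓡 n)) q).target (extChartAt (𝓡 n) q.2).target :=
        fun z hz => mem_extChartAt_prod_target.1 hz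
      have hNc : ContDiffOn ℝ ∞ (N ∘ (extChartAt (𝓡 n) q.2).symm) (extChartAt (𝓡 n) q.2).target :=
        contMDiffOn_iff_contDiffOn.1
          (hN.comp_contMDiffOn (contMDiffOn_extChartAt_symm (n := ∞) q.2))
      have h2 : ContDiffOn ℝ ∞ (fun y => hg.coordForm q.2 y u.2 v.2)
          (extChartAt (𝓡 n) q.2).target :=
        ((hg.contDiffOn_coordForm q.2).clm_apply contDiffOn_const).clm_apply contDiffOn_const
      exact (h2.comp contDiffOn_snd hmaps).sub
        (((hNc.comp contDiffOn_snd hmaps).pow 2).mul contDiffOn_const)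
    exact h1.congr fun z hz =>
      coordMetric_staticMetric hg (mem_extChartAt_prod_target.1 hz) u v

variable {f : M → ℝ}

theorem mvfderiv_timeIndependent {p : ℝ × M} (hf : MDifferentiableAt (𝓡 n) 𝓘(ℝ, ℝ) f p.2)
    (u : TangentSpace (𝓘(ℝ, ℝ).prod (𝓡 n)) p) :
    mvfderiv (𝓘(ℝ, ℝ).prod (𝓡 n)) (timeIndependent f) p u =
      mvfderiv (𝓡 n) f p.2 (spaceComp p u) := by
  have h := mfderiv_comp (I := 𝓘(ℝ, ℝ).prod (𝓡 n)) (I' := 𝓡 n) (I'' := 𝓘(ℝ, ℝ)) p hf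
    mdifferentiableAt_snd
  exact congrArg (fun l => l u) h

theorem IsGradient.timeIndependent {p : ℝ × M}
    (hf : MDifferentiableAt (𝓡 n) 𝓘(ℝ, ℝ) f p.2) {ξ : TangentSpace (𝓡 n) p.2}
    (hξ : IsGradient g f p.2 ξ) :
    IsGradient (staticMetric g N) (timeIndependent f) p (liftVector p 0 ξ) := by
  intro v
  rw [staticMetric_apply, timeComp_liftVector, spaceComp_liftVector, hξ,
    mvfderiv_timeIndependent hf]
  ring

/-- The gradient has no time component and the metric does not depend on time. So the only new
Christoffel term is half the derivative of `N²` along `ξ` on the time components, which is `N ξ(N)`.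
-/
theorem hessianAt_timeIndependent (hg : IsSmoothMetric g) (hN : ContMDiff (𝓡 n) 𝓘(ℝ, ℝ) ∞ N)
    (hG : IsSmoothMetric (staticMetric g N)) {p : ℝ × M}
    (hf : ContMDiffAt (𝓡 n) 𝓘(ℝ, ℝ) ∞ f p.2) (ξ : TangentSpace (𝓡 n) p.2)
    (u v : TangentSpace (𝓘(ℝ, ℝ).prod (𝓡 n)) p) :
    hessianAt hG p (timeIndependent f) p (liftVector p 0 ξ) u v =
      hessianAt hg p.2 f p.2 ξ (spaceComp p u) (spaceComp p v)
        - N p.2 * mvfderiv (𝓡 n) N p.2 ξ * (timeComp p u * timeComp p v) := by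
  have hp := mem_chart_source (EuclideanSpace ℝ (Fin n)) p.2
  have hpe : p.2 ∈ (extChartAt (𝓡 n) p.2).source := by rwa [extChartAt_source]
  have ht := (extChartAt (𝓡 n) p.2).map_source hpe
  set φ := extChartAt (𝓡 n) p.2 with hφ
  have hz : extChartAt (𝓘(ℝ, ℝ).prod (𝓡 n)) p p = (p.1, φ p.2) := extChartAt_prod_apply (n := n) p p
  have hzt : ((p.1, φ p.2) : ℝ × EuclideanSpace ℝ (Fin n)) ∈ (extChartAt (𝓘(ℝ, ℝ).prod (𝓡 n)) p).target :=
    mem_extChartAt_prod_target.2 ht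
  set F : EuclideanSpace ℝ (Fin n) → ℝ := f ∘ φ.symm with hF
  set k : EuclideanSpace ℝ (Fin n) → ℝ := N ∘ φ.symm with hk
  have hFc : ContDiffAt ℝ ∞ F (φ p.2) := contDiffAt_comp_extChartAt_symm le_rfl hp hf
  have hkc : ContDiffAt ℝ ∞ k (φ p.2) := contDiffAt_comp_extChartAt_symm le_rfl hp (hN _)
  have hkp : k (φ p.2) = N p.2 := by
    change N (φ.symm (φ p.2)) = _
    rw [φ.left_inv hpe]
  have hcomp : timeIndependent f ∘ (extChartAt (𝓘(ℝ, ℝ).prod (𝓡 n)) p).symm = F ∘ Prod.snd := by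
    funext z
    change f ((extChartAt (𝓘(ℝ, ℝ).prod (𝓡 n)) p).symm z).2 = _
    rw [extChartAt_prod_symm_apply]
    rfl
  have hD : ∀ a b : ℝ × EuclideanSpace ℝ (Fin n), fderiv ℝ (fderiv ℝ (F ∘ Prod.snd)) ((p.1, φ p.2) : ℝ × EuclideanSpace ℝ (Fin n)) a b =
      fderiv ℝ (fderiv ℝ F) (φ p.2) a.2 b.2 := fun a b => by
    have hsnd : ContDiffAt ℝ ∞ (Prod.snd : ℝ × EuclideanSpace ℝ (Fin n) → EuclideanSpace ℝ (Fin n)) (p.1, φ p.2) := contDiffAt_snd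
    have e : fderiv ℝ (F ∘ Prod.snd) =ᶠ[𝓝 ((p.1, φ p.2) : ℝ × EuclideanSpace ℝ (Fin n))]
        fun z => (fderiv ℝ F z.2).comp (ContinuousLinearMap.snd ℝ ℝ (EuclideanSpace ℝ (Fin n))) := by
      have hFe : ∀ᶠ z : ℝ × EuclideanSpace ℝ (Fin n) in 𝓝 (p.1, φ p.2), DifferentiableAt ℝ F z.2 :=
        hsnd.continuousAt.eventually (((hFc.of_le two_le_infty).eventually (by simp)).mono
          fun y hy => hy.differentiableAt (by simp))
      filter_upwards [hFe] with z hz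
      rw [fderiv_comp z hz differentiableAt_snd, fderiv_snd]
    have hd : HasFDerivAt (fun z : ℝ × EuclideanSpace ℝ (Fin n) => fderiv ℝ F z.2)
        ((fderiv ℝ (fderiv ℝ F) (φ p.2)).comp (ContinuousLinearMap.snd ℝ ℝ (EuclideanSpace ℝ (Fin n)))) (p.1, φ p.2) :=
      HasFDerivAt.comp (g := fderiv ℝ F) (p.1, φ p.2) (((hFc.fderiv_right (m := ∞) (by simp)).differentiableAt
        (by simp)).hasFDerivAt) hasFDerivAt_snd
    rw [e.fderiv_eq, (hd.clm_comp (hasFDerivAt_const _ _)).fderiv]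
    simp
  have hB : ∀ a b c : ℝ × EuclideanSpace ℝ (Fin n), fderiv ℝ (hG.coordForm p) ((p.1, φ p.2) : ℝ × EuclideanSpace ℝ (Fin n)) a b c =
      fderiv ℝ (hg.coordForm p.2) (φ p.2) a.2 b.2 c.2
        - 2 * k (φ p.2) * fderiv ℝ k (φ p.2) a.2 * (b.1 * c.1) := fun a b c => by
    rw [← fderiv_clm_apply₂ (hG.differentiableAt_coordForm hzt)]
    have e : (fun z => hG.coordForm p z b c) =ᶠ[𝓝 ((p.1, φ p.2) : ℝ × EuclideanSpace ℝ (Fin n))]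
        fun z => hg.coordForm p.2 z.2 b.2 c.2 - k z.2 ^ 2 * (b.1 * c.1) := by
      filter_upwards [(isOpen_extChartAt_target p).mem_nhds hzt] with z hz
      exact coordMetric_staticMetric hg (mem_extChartAt_prod_target.1 hz) b c
    have h1 : HasFDerivAt (fun y => hg.coordForm p.2 y b.2 c.2)
        (((fderiv ℝ (hg.coordForm p.2) (φ p.2)).flip b.2).flip c.2) (φ p.2) := by
      simpa using ((hg.differentiableAt_coordForm ht).hasFDerivAt.clm_apply
        (hasFDerivAt_const b.2 _)).clm_apply (hasFDerivAt_const c.2 _)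
    have h2 : HasFDerivAt k (fderiv ℝ k (φ p.2)) (φ p.2) :=
      (hkc.differentiableAt (by simp)).hasFDerivAt
    have h3 : HasFDerivAt (fun z : ℝ × EuclideanSpace ℝ (Fin n) => hg.coordForm p.2 z.2 b.2 c.2
        - k z.2 ^ 2 * (b.1 * c.1)) _ (p.1, φ p.2) :=
      HasFDerivAt.comp (g := fun y => hg.coordForm p.2 y b.2 c.2 - k y ^ 2 * (b.1 * c.1))
        (p.1, φ p.2) (h1.sub ((h2.pow 2).mul_const (b.1 * c.1))) hasFDerivAt_snd
    rw [e.fderiv_eq, h3.fderiv]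
    simp
    ring
  have hNξ : mvfderiv (𝓡 n) N p.2 ξ = fderiv ℝ k (φ p.2) (toCoord p.2 p.2 ξ) :=
    mvfderiv_eq_fderiv_toCoord hp ((hN p.2).mdifferentiableAt (by simp)) ξ
  rw [hessianAt, hessianAt, coordHessian, coordHessian, christoffelForm, christoffelForm, hcomp,
    hz, hD]
  simp only [hB, toCoord_fst hp, toCoord_snd hp, timeComp_liftVector, spaceComp_liftVector, hNξ,
    hkp]
  ring

end Static

/-! ### Polarization of the Hessian; length and uniqueness of gradients. -/

section HessianAlgebra

set_option maxSynthPendingDepth 3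
set_option linter.unusedSectionVars false

variable {V : Type*} [NormedAddCommGroup V] [NormedSpace ℝ V] [FiniteDimensional ℝ V]
  {H : Type*} [TopologicalSpace H] {J : ModelWithCorners ℝ V H} [J.Boundaryless]
  {X : Type*} [TopologicalSpace X] [ChartedSpace H X] [IsManifold J ∞ X]
  {G : MetricField J X} {f : X → ℝ} {x : X}

/-- Symmetry of the Hessian in polarized form: null vectors only reveal diagonal values, and this
recovers the others. -/
theorem hessianAt_add_self (hG : IsSmoothMetric G) (hf : ContMDiffAt J 𝓘(ℝ, ℝ) ∞ f x)
    (ξ u v : TangentSpace J x) :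
    hessianAt hG x f x ξ (u + v) (u + v) =
      hessianAt hG x f x ξ u u + 2 * hessianAt hG x f x ξ u v + hessianAt hG x f x ξ v v := by
  have hx := mem_chart_source H x
  have hxe : x ∈ (extChartAt J x).source := by rwa [extChartAt_source]
  have ht := (extChartAt J x).map_source hxe
  have hsymm : ∀ a b, fderiv ℝ (fderiv ℝ (f ∘ (extChartAt J x).symm)) (extChartAt J x x) a b =
      fderiv ℝ (fderiv ℝ (f ∘ (extChartAt J x).symm)) (extChartAt J x x) b a := fun a b =>
    ((contDiffAt_comp_extChartAt_symm le_rfl hx hf).isSymmSndFDerivAt (by simp [two_le_infty])) a b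
  have hB : ∀ a b c, fderiv ℝ (hG.coordForm x) (extChartAt J x x) a b c =
      fderiv ℝ (hG.coordForm x) (extChartAt J x x) a c b := fun a b c => by
    rw [← fderiv_clm_apply₂ (hG.differentiableAt_coordForm ht),
      ← fderiv_clm_apply₂ (hG.differentiableAt_coordForm ht)]
    simp only [hG.coordForm_symm x _ b c]
  simp only [hessianAt, coordHessian, christoffelForm, map_add, add_apply]
  rw [hsymm (toCoord x x v) (toCoord x x u), hB (toCoord x x ξ) (toCoord x x v) (toCoord x x u)]
  ring

theorem differentialLength_eq (hG : IsSmoothMetric G) {ξ : TangentSpace J x}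
    (hξ : IsGradient G f x ξ) : differentialLength G f x = Real.sqrt (mvfderiv J f x ξ) := by
  rw [differentialLength]
  congr 1
  exact metricTrace_mul_self (hG.bilin x)
    (fun u hu => hG.nondegenerate x u fun v => (hG.symm x u v).trans (hu v)) (hG.symm x)
    (mvfderiv J f x).toLinearMap ξ hξ

theorem IsGradient.unique (hG : IsSmoothMetric G) {ξ ξ' : TangentSpace J x}
    (hξ : IsGradient G f x ξ) (hξ' : IsGradient G f x ξ') : ξ = ξ' := by
  rw [← sub_eq_zero]
  refine hG.nondegenerate x _ fun v => ?_
  rw [sub_eq_add_neg, ← neg_one_smul ℝ, hG.add_left, hG.smul_left, hξ, hξ']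
  ring

end HessianAlgebra

/-! ### Hypersurfaces `ℝ × S` in a static spacetime. -/

section StaticHypersurface

set_option maxSynthPendingDepth 3
set_option linter.unusedSectionVars false

variable {n : ℕ} {M : Type*} [TopologicalSpace M] [ChartedSpace (EuclideanSpace ℝ (Fin n)) M]
  [IsManifold (𝓡 n) ∞ M] {S U : Set M} {f N : M → ℝ}

theorem IsDefiningFunction.timeIndependent (hf : IsDefiningFunction (𝓡 n) S U f) :
    IsDefiningFunction (𝓘(ℝ, ℝ).prod (𝓡 n)) ((univ : Set ℝ) ×ˢ S) (univ ×ˢ U)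
      (timeIndependent f) where
  isOpen := isOpen_univ.prod hf.isOpen
  contMDiffOn := hf.contMDiffOn.comp contMDiffOn_snd fun p hp => hp.2
  ne_zero p hp h := by
    refine hf.ne_zero p.2 hp.2 (ContinuousLinearMap.ext fun v => ?_)
    have := mvfderiv_timeIndependent (hf.mdifferentiableAt hp.2) (liftVector p 0 v)
    rw [spaceComp_liftVector, h] at this
    exact this.symm
  inter_eq := by
    ext p
    have := Set.ext_iff.1 hf.inter_eq p.2
    simpa [PhotonSphere.timeIndependent] using this

theorem IsHypersurface.univ_prod (hS : IsHypersurface (𝓡 n) S) :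
    IsHypersurface (𝓘(ℝ, ℝ).prod (𝓡 n)) ((univ : Set ℝ) ×ˢ S) := fun p hp => by
  obtain ⟨U, f, hpU, hf⟩ := hS.exists_isDefiningFunction hp.2
  have h := hf.timeIndependent
  exact ⟨_, h.isOpen, ⟨mem_univ _, hpU⟩, _, h.contMDiffOn, h.ne_zero, h.inter_eq⟩

theorem IsDefiningFunction.mem_tangentSpaceOf_univ_prod_iff (hf : IsDefiningFunction (𝓡 n) S U f)
    {p : ℝ × M} (hp : p.2 ∈ S) (hpU : p.2 ∈ U)
    {Z : TangentSpace (𝓘(ℝ, ℝ).prod (𝓡 n)) p} :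
    Z ∈ tangentSpaceOf (𝓘(ℝ, ℝ).prod (𝓡 n)) ((univ : Set ℝ) ×ˢ S) p ↔
      spaceComp p Z ∈ tangentSpaceOf (𝓡 n) S p.2 := by
  rw [hf.timeIndependent.mem_tangentSpaceOf_iff ⟨mem_univ _, hp⟩ ⟨mem_univ _, hpU⟩,
    hf.mem_tangentSpaceOf_iff hp hpU, mvfderiv_timeIndependent (hf.mdifferentiableAt hpU)]

/-- A function that is constant along a hypersurface and not critical there has nonzero derivative
in the normal direction. -/
theorem IsDefiningFunction.mvfderiv_gradient_ne_zero (hf : IsDefiningFunction (𝓡 n) S U f)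
    {x : M} (hx : x ∈ S) (hxU : x ∈ U) (hN : ContMDiff (𝓡 n) 𝓘(ℝ, ℝ) ∞ N)
    (hNS : IsConstOn N S) (hdN : mvfderiv (𝓡 n) N x ≠ 0) {ξ : TangentSpace (𝓡 n) x}
    (hξ : mvfderiv (𝓡 n) f x ξ ≠ 0) : mvfderiv (𝓡 n) N x ξ ≠ 0 := by
  intro h0
  apply hdN
  obtain ⟨c, hc⟩ := hNS
  have hNd : MDifferentiableAt (𝓡 n) 𝓘(ℝ, ℝ) N x := (hN x).mdifferentiableAt (by simp)
  ext v
  have hv : v - (mvfderiv (𝓡 n) f x v / mvfderiv (𝓡 n) f x ξ) • ξ ∈ tangentSpaceOf (𝓡 n) S x := by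
    rw [hf.mem_tangentSpaceOf_iff hx hxU, map_sub, map_smul, smul_eq_mul, div_mul_cancel₀ _ hξ,
      sub_self]
  -- As `N - c` vanishes on `S`, `dN` kills tangent vectors; if it also killed the transversal `ξ`,
  -- it would be zero.
  have h1 := hv univ isOpen_univ (mem_univ x) (fun y => N y - c)
    (hN.sub contMDiff_const).contMDiffOn fun y hy => by rw [hc y hy.1, sub_self]
  rw [mvfderiv_fun_sub hNd mdifferentiableAt_const, mvfderiv_const, sub_zero, map_sub, map_smul, h0,
    smul_zero, sub_zero] at h1
  simpa using h1

theorem isNondegenerate_univ_prod_iff (hN : ContMDiff (𝓡 n) 𝓘(ℝ, ℝ) ∞ N) :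
    IsNondegenerate n N ((univ : Set ℝ) ×ˢ S) ↔ ∀ x ∈ S, mvfderiv (𝓡 n) N x ≠ 0 := by
  have hNd : ∀ x, MDifferentiableAt (𝓡 n) 𝓘(ℝ, ℝ) N x := fun x =>
    (hN x).mdifferentiableAt (by simp)
  constructor
  · intro h x hx h0
    refine h (0, x) ⟨mem_univ _, hx⟩ (ContinuousLinearMap.ext fun v => ?_)
    rw [mvfderiv_timeIndependent (hNd _), h0]
    rfl
  · intro h p hp h0
    refine h p.2 hp.2 (ContinuousLinearMap.ext fun v => ?_)
    have := mvfderiv_timeIndependent (hNd p.2) (liftVector p 0 v)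
    rw [spaceComp_liftVector, h0] at this
    exact this.symm

theorem isConstOn_univ_prod_iff {k : ℝ × M → ℝ} {k' : M → ℝ} (h : ∀ p, k p = k' p.2) :
    IsConstOn k ((univ : Set ℝ) ×ˢ S) ↔ IsConstOn k' S :=
  ⟨fun ⟨c, hc⟩ => ⟨c, fun x hx => (h (0, x)).symm.trans (hc (0, x) ⟨mem_univ _, hx⟩)⟩,
    fun ⟨c, hc⟩ => ⟨c, fun p hp => (h p).trans (hc p.2 hp.2)⟩⟩

theorem timeSlice_univ_prod (S : Set M) (t : ℝ) : timeSlice ((univ : Set ℝ) ×ˢ S) t = S := by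
  ext x
  simp [timeSlice]

theorem isConstOn_iff_of_eq_mul {A : Type*} {k k' : A → ℝ} {T : Set A} {c : ℝ}
    (hc : c ≠ 0) (h : ∀ x ∈ T, k x = c * k' x) : IsConstOn k T ↔ IsConstOn k' T := by
  constructor
  · rintro ⟨d, hd⟩
    refine ⟨c⁻¹ * d, fun x hx => ?_⟩
    rw [← hd x hx, h x hx, inv_mul_cancel_left₀ hc]
  · rintro ⟨d, hd⟩
    exact ⟨c * d, fun x hx => by rw [h x hx, hd x hx]⟩

variable (g : ContMDiffRiemannianMetric (𝓡 n) ∞ (EuclideanSpace ℝ (Fin n))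
  (fun x : M => TangentSpace (𝓡 n) x))

theorem IsDefiningFunction.gradient_pos (hf : IsDefiningFunction (𝓡 n) S U f) {x : M}
    (hxU : x ∈ U) {ξ : TangentSpace (𝓡 n) x} (hξ : IsGradient (metricField g) f x ξ) :
    0 < metricField g x ξ ξ := by
  refine g.pos x ξ fun h => hf.ne_zero x hxU (ContinuousLinearMap.ext fun v => ?_)
  rw [← hξ, h]
  simp [metricField]

theorem IsDefiningFunction.isUnitNormal_smul_gradient (hf : IsDefiningFunction (𝓡 n) S U f) {x : M}
    (hx : x ∈ S) (hxU : x ∈ U) {ξ : TangentSpace (𝓡 n) x}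
    (hξ : IsGradient (metricField g) f x ξ) :
    IsUnitNormal (metricField g) S x ((Real.sqrt (metricField g x ξ ξ))⁻¹ • ξ) := by
  have hg := isSmoothMetric_metricField g
  have hpos := hf.gradient_pos g hxU hξ
  constructor
  · intro w hw
    rw [hg.smul_left, hξ w, (hf.mem_tangentSpaceOf_iff hx hxU).1 hw, mul_zero]
  · rw [hg.smul_left, hg.smul_right, ← mul_assoc, ← mul_inv, Real.mul_self_sqrt hpos.le,
      inv_mul_cancel₀ hpos.ne']

theorem liftVector_gradient_inner (p : ℝ × M) (ξ : TangentSpace (𝓡 n) p.2) :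
    staticMetric (metricField g) N p (liftVector p 0 ξ) (liftVector p 0 ξ) =
      metricField g p.2 ξ ξ := by
  rw [staticMetric_apply, timeComp_liftVector, spaceComp_liftVector]
  ring

variable {g}

/-- For a photon surface `ℝ × S`, the Hessian of a defining function of `S` is pure trace, with
factor determined by the lapse. -/
theorem hessianAt_eq_of_isPhotonSurface (hN : ContMDiff (𝓡 n) 𝓘(ℝ, ℝ) ∞ N)
    (hNpos : ∀ x, 0 < N x)
    (hP : IsPhotonSurface (staticMetric (metricField g) N) ((univ : Set ℝ) ×ˢ S))
    (hf : IsDefiningFunction (𝓡 n) S U f) {x : M} (hx : x ∈ S) (hxU : x ∈ U)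
    {ξ : TangentSpace (𝓡 n) x} (hξ : IsGradient (metricField g) f x ξ)
    {u : TangentSpace (𝓡 n) x} (hu : u ∈ tangentSpaceOf (𝓡 n) S x)
    {v : TangentSpace (𝓡 n) x} (hv : v ∈ tangentSpaceOf (𝓡 n) S x) :
    hessianAt (isSmoothMetric_metricField g) x f x ξ u v =
      mvfderiv (𝓡 n) N x ξ / N x * metricField g x u v := by
  have hg := isSmoothMetric_metricField g
  have hG := isSmoothMetric_staticMetric hg hN hNpos
  have hNx := hNpos x
  have hdiag : ∀ u ∈ tangentSpaceOf (𝓡 n) S x, hessianAt hg x f x ξ u u =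
      mvfderiv (𝓡 n) N x ξ / N x * metricField g x u u := by
    intro u hu
    by_cases hu0 : u = 0
    · subst hu0
      simp [hessianAt, coordHessian, christoffelForm, metricField]
    -- The time component that makes the lift of `u` null.
    set a := Real.sqrt (metricField g x u u) / N x with ha
    have haa : N x ^ 2 * (a * a) = metricField g x u u := by
      rw [ha, div_mul_div_comm, Real.mul_self_sqrt (metricField_self_nonneg g x u)]
      field_simp
    let p : ℝ × M := (0, x)
    have hs : spaceComp p (liftVector p a u) = u := spaceComp_liftVector p a u
    have h := hP.hessianAt_eq_zero hG hf.timeIndependent (p := p) ⟨mem_univ _, hx⟩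
      ⟨mem_univ _, hxU⟩ (IsGradient.timeIndependent (hf.mdifferentiableAt hxU) hξ)
      (Z := liftVector p a u)
      ((hf.mem_tangentSpaceOf_univ_prod_iff (p := p) hx hxU).2 (by rwa [hs]))
      (fun h0 => hu0 (by rw [← hs, h0, map_zero]))
      (by
        rw [staticMetric_apply, hs, timeComp_liftVector, haa]
        exact sub_self _)
    rw [hessianAt_timeIndependent hg hN hG (hf.contMDiffAt hxU), hs, timeComp_liftVector] at h
    have h' : hessianAt hg x f x ξ u u - N x * mvfderiv (𝓡 n) N x ξ * (a * a) = 0 := h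
    rw [← haa]
    field_simp
    linarith
  have h1 := hdiag _ (Submodule.add_mem _ hu hv)
  rw [hessianAt_add_self hg (hf.contMDiffAt hxU), hdiag u hu, hdiag v hv, hg.add_left,
    hg.add_right, hg.add_right, hg.symm x v u] at h1
  linarith

theorem IsPhotonSphere.exists_eq_univ_prod {P : Set (ℝ × M)}
    (hP : IsPhotonSphere (metricField g) N P) :
    ∃ S : Set M, IsHypersurface (𝓡 n) S ∧ P = univ ×ˢ S ∧ IsConstOn N S := by
  obtain ⟨-, ⟨S, hS, rfl⟩, hc⟩ := hP
  exact ⟨S, hS, rfl, (isConstOn_univ_prod_iff fun _ => rfl).1 hc⟩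

/-- If `ℝ × S` is a photon surface, then `S` has mean curvature `H = (n - 1) ν(N) / N`. -/
theorem meanCurvature_eq_of_isPhotonSurface (hN : ContMDiff (𝓡 n) 𝓘(ℝ, ℝ) ∞ N)
    (hNpos : ∀ x, 0 < N x)
    (hP : IsPhotonSurface (staticMetric (metricField g) N) ((univ : Set ℝ) ×ˢ S))
    (hS : IsHypersurface (𝓡 n) S) {x : M} (hx : x ∈ S) {ν : TangentSpace (𝓡 n) x}
    (hν : IsUnitNormal (metricField g) S x ν) :
    meanCurvature (metricField g) S x ν = ((n : ℝ) - 1) / N x * mvfderiv (𝓡 n) N x ν := by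
  have hg := isSmoothMetric_metricField g
  obtain ⟨U, f, hxU, hf⟩ := hS.exists_isDefiningFunction hx
  obtain ⟨ξ, hξ⟩ := IsDefiningFunction.exists_isGradient hg f x
  obtain ⟨a, rfl, -⟩ := hf.exists_unitNormal_eq_smul hg hx hxU hξ hν
  rw [hf.meanCurvature_eq hg hx hxU hξ (hf.gradient_pos g hxU hξ).ne'
    (c := a * (mvfderiv (𝓡 n) N x ξ / N x)) fun u hu v hv => ?_]
  · rw [finrank_euclideanSpace_fin, map_smul, smul_eq_mul]
    ring
  · rw [hf.secondFundamentalForm_eq hg hx hxU hξ a hu hv,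
      hessianAt_eq_of_isPhotonSurface hN hNpos hP hf hx hxU hξ hu hv, mul_assoc]

/-- A photon surface `ℝ × S` has mean curvature `𝔥 = n η(N) / N` in the spacetime. -/
theorem meanCurvature_univ_prod_eq_of_isPhotonSurface (hN : ContMDiff (𝓡 n) 𝓘(ℝ, ℝ) ∞ N)
    (hNpos : ∀ x, 0 < N x)
    (hP : IsPhotonSurface (staticMetric (metricField g) N) ((univ : Set ℝ) ×ˢ S))
    (hS : IsHypersurface (𝓡 n) S) {p : ℝ × M} (hp : p.2 ∈ S)
    {η : TangentSpace (𝓘(ℝ, ℝ).prod (𝓡 n)) p}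
    (hη : IsUnitNormal (staticMetric (metricField g) N) (univ ×ˢ S) p η) :
    meanCurvature (staticMetric (metricField g) N) (univ ×ˢ S) p η =
      n / N p.2 * mvfderiv (𝓘(ℝ, ℝ).prod (𝓡 n)) (timeIndependent N) p η := by
  have hg := isSmoothMetric_metricField g
  have hG := isSmoothMetric_staticMetric hg hN hNpos
  have hNp := (hNpos p.2).ne'
  obtain ⟨U, f, hxU, hf⟩ := hS.exists_isDefiningFunction hp
  obtain ⟨ξ, hξ⟩ := IsDefiningFunction.exists_isGradient hg f p.2
  have hp' : p ∈ (univ : Set ℝ) ×ˢ S := ⟨mem_univ _, hp⟩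
  have hpU' : p ∈ (univ : Set ℝ) ×ˢ U := ⟨mem_univ _, hxU⟩
  have hξ' := IsGradient.timeIndependent (N := N) (hf.mdifferentiableAt hxU) hξ
  obtain ⟨a, rfl, -⟩ := hf.timeIndependent.exists_unitNormal_eq_smul hG hp' hpU' hξ' hη
  rw [hf.timeIndependent.meanCurvature_eq hG hp' hpU' hξ'
    (by rw [liftVector_gradient_inner]; exact (hf.gradient_pos g hxU hξ).ne')
    (c := a * (mvfderiv (𝓡 n) N p.2 ξ / N p.2)) fun u hu v hv => ?_]
  -- The spacetime has dimension `n + 1`, so the trace over `ℝ × S` has the factor `n`.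
  · rw [Module.finrank_prod, finrank_euclideanSpace_fin, Module.finrank_self, map_smul,
      smul_eq_mul, mvfderiv_timeIndependent ((hN p.2).mdifferentiableAt (by simp)),
      spaceComp_liftVector]
    push_cast
    ring
  -- Here `(ξ(N) / N) g - N ξ(N) dt²` equals `(ξ(N) / N) (g - N² dt²)`, so the Hessian is pure trace
  -- for the spacetime metric as well.
  · rw [hf.timeIndependent.secondFundamentalForm_eq hG hp' hpU' hξ' a hu hv,
      hessianAt_timeIndependent hg hN hG (hf.contMDiffAt hxU),
      hessianAt_eq_of_isPhotonSurface hN hNpos hP hf hp hxU hξ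
        ((hf.mem_tangentSpaceOf_univ_prod_iff hp hxU).1 hu)
        ((hf.mem_tangentSpaceOf_univ_prod_iff hp hxU).1 hv), staticMetric_apply]
    field_simp

theorem isTotallyUmbilic_of_isPhotonSurface (hN : ContMDiff (𝓡 n) 𝓘(ℝ, ℝ) ∞ N)
    (hNpos : ∀ x, 0 < N x)
    (hP : IsPhotonSurface (staticMetric (metricField g) N) ((univ : Set ℝ) ×ˢ S))
    (hS : IsHypersurface (𝓡 n) S) : IsTotallyUmbilic (metricField g) S := by
  intro x hx ν hν
  have hg := isSmoothMetric_metricField g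
  obtain ⟨U, f, hxU, hf⟩ := hS.exists_isDefiningFunction hx
  obtain ⟨ξ, hξ⟩ := IsDefiningFunction.exists_isGradient hg f x
  obtain ⟨a, rfl, -⟩ := hf.exists_unitNormal_eq_smul hg hx hxU hξ hν
  refine ⟨a * (mvfderiv (𝓡 n) N x ξ / N x), fun u hu v hv => ?_⟩
  rw [hf.secondFundamentalForm_eq hg hx hxU hξ a hu hv,
    hessianAt_eq_of_isPhotonSurface hN hNpos hP hf hx hxU hξ hu hv, mul_assoc]

theorem mvfderiv_unitNormal_ne_zero (hN : ContMDiff (𝓡 n) 𝓘(ℝ, ℝ) ∞ N)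
    (hS : IsHypersurface (𝓡 n) S) (hNS : IsConstOn N S) {x : M} (hx : x ∈ S)
    (hdN : mvfderiv (𝓡 n) N x ≠ 0) {ν : TangentSpace (𝓡 n) x}
    (hν : IsUnitNormal (metricField g) S x ν) : mvfderiv (𝓡 n) N x ν ≠ 0 := by
  have hg := isSmoothMetric_metricField g
  obtain ⟨U, f, hxU, hf⟩ := hS.exists_isDefiningFunction hx
  obtain ⟨ξ, hξ⟩ := IsDefiningFunction.exists_isGradient hg f x
  obtain ⟨a, rfl, ha⟩ := hf.exists_unitNormal_eq_smul hg hx hxU hξ hν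
  rw [map_smul, smul_eq_mul]
  refine mul_ne_zero ha (hf.mvfderiv_gradient_ne_zero hx hxU hN hNS hdN ?_)
  rw [← hξ]
  exact (hf.gradient_pos g hxU hξ).ne'

theorem mvfderiv_timeIndependent_unitNormal_ne_zero (hN : ContMDiff (𝓡 n) 𝓘(ℝ, ℝ) ∞ N)
    (hNpos : ∀ x, 0 < N x) (hS : IsHypersurface (𝓡 n) S) (hNS : IsConstOn N S) {p : ℝ × M}
    (hp : p.2 ∈ S) (hdN : mvfderiv (𝓡 n) N p.2 ≠ 0)
    {η : TangentSpace (𝓘(ℝ, ℝ).prod (𝓡 n)) p}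
    (hη : IsUnitNormal (staticMetric (metricField g) N) (univ ×ˢ S) p η) :
    mvfderiv (𝓘(ℝ, ℝ).prod (𝓡 n)) (timeIndependent N) p η ≠ 0 := by
  have hg := isSmoothMetric_metricField g
  have hG := isSmoothMetric_staticMetric hg hN hNpos
  obtain ⟨U, f, hxU, hf⟩ := hS.exists_isDefiningFunction hp
  obtain ⟨ξ, hξ⟩ := IsDefiningFunction.exists_isGradient hg f p.2
  obtain ⟨a, rfl, ha⟩ := hf.timeIndependent.exists_unitNormal_eq_smul hG
    (⟨mem_univ _, hp⟩ : p ∈ (univ : Set ℝ) ×ˢ S) ⟨mem_univ _, hxU⟩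
    (IsGradient.timeIndependent (N := N) (hf.mdifferentiableAt hxU) hξ) hη
  rw [map_smul, smul_eq_mul, mvfderiv_timeIndependent ((hN p.2).mdifferentiableAt (by simp)),
    spaceComp_liftVector]
  refine mul_ne_zero ha (hf.mvfderiv_gradient_ne_zero hp hxU hN hNS hdN ?_)
  rw [← hξ]
  exact (hf.gradient_pos g hxU hξ).ne'

/-- Umbilicity leaves one unknown factor, which the constraint determines: for `n ≥ 2` the factor `n
- 1` cancels and leaves `ν(N) / N`. -/
theorem hessianAt_eq_of_isTotallyUmbilic (hn : 2 ≤ n) (hNpos : ∀ x, 0 < N x)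
    (hU : IsTotallyUmbilic (metricField g) S) (hC : PhotonSphereConstraint (metricField g) N S)
    (hf : IsDefiningFunction (𝓡 n) S U f) {x : M} (hx : x ∈ S) (hxU : x ∈ U)
    {ξ : TangentSpace (𝓡 n) x} (hξ : IsGradient (metricField g) f x ξ)
    {u : TangentSpace (𝓡 n) x} (hu : u ∈ tangentSpaceOf (𝓡 n) S x)
    {v : TangentSpace (𝓡 n) x} (hv : v ∈ tangentSpaceOf (𝓡 n) S x) :
    hessianAt (isSmoothMetric_metricField g) x f x ξ u v =
      mvfderiv (𝓡 n) N x ξ / N x * metricField g x u v := by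
  have hg := isSmoothMetric_metricField g
  have hpos := hf.gradient_pos g hxU hξ
  have hν := hf.isUnitNormal_smul_gradient g hx hxU hξ
  have ha : (Real.sqrt (metricField g x ξ ξ))⁻¹ ≠ 0 := inv_ne_zero (Real.sqrt_pos.2 hpos).ne'
  have hNx := (hNpos x).ne'
  obtain ⟨b, hb⟩ := hU x hx _ hν
  have hH := hC x hx _ hν
  rw [hf.meanCurvature_eq hg hx hxU hξ hpos.ne' hb, finrank_euclideanSpace_fin, map_smul,
    smul_eq_mul] at hH
  have hsff := hb u hu v hv
  rw [hf.secondFundamentalForm_eq hg hx hxU hξ _ hu hv] at hsff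
  generalize (Real.sqrt (metricField g x ξ ξ))⁻¹ = a at *
  have hn1 : (n : ℝ) - 1 ≠ 0 := by
    have : (2 : ℝ) ≤ n := by exact_mod_cast hn
    linarith
  have h1 : N x * b = a * mvfderiv (𝓡 n) N x ξ :=
    mul_left_cancel₀ hn1 (by linear_combination hH)
  rw [div_mul_eq_mul_div, eq_div_iff hNx]
  refine mul_left_cancel₀ ha ?_
  linear_combination N x * hsff + metricField g x u v * h1

/-- The time direction is tangent with length squared `-N²`, so the product is timelike. By the
prescribed umbilicity factor, the spacetime Hessian on tangent vectors is a multiple of the metric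
and so vanishes on null vectors. -/
theorem isPhotonSurface_of_isTotallyUmbilic (hn : 2 ≤ n) (hN : ContMDiff (𝓡 n) 𝓘(ℝ, ℝ) ∞ N)
    (hNpos : ∀ x, 0 < N x) (hS : IsHypersurface (𝓡 n) S)
    (hU : IsTotallyUmbilic (metricField g) S)
    (hC : PhotonSphereConstraint (metricField g) N S) :
    IsPhotonSurface (staticMetric (metricField g) N) ((univ : Set ℝ) ×ˢ S) := by
  have hg := isSmoothMetric_metricField g
  have hG := isSmoothMetric_staticMetric hg hN hNpos
  refine isPhotonSurface_of_hessianAt_eq_zero hG ⟨hS.univ_prod, fun p hp => ?_⟩ fun p hp => ?_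
  · obtain ⟨U, f, hxU, hf⟩ := hS.exists_isDefiningFunction hp.2
    refine ⟨liftVector p 1 0, (hf.mem_tangentSpaceOf_univ_prod_iff hp.2 hxU).2 ?_, ?_⟩
    · rw [spaceComp_liftVector]
      exact Submodule.zero_mem _
    · have h0 : metricField g p.2 0 0 = 0 := by simp [metricField]
      rw [staticMetric_apply, spaceComp_liftVector, timeComp_liftVector, h0]
      nlinarith [hNpos p.2]
  · obtain ⟨U, f, hxU, hf⟩ := hS.exists_isDefiningFunction hp.2
    refine ⟨univ ×ˢ U, timeIndependent f, ⟨mem_univ _, hxU⟩, hf.timeIndependent,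
      fun x hx hxU ξ' hξ' => ?_⟩
    obtain ⟨ξ, hξ⟩ := IsDefiningFunction.exists_isGradient hg f x.2
    obtain rfl := hξ'.unique hG (IsGradient.timeIndependent (hf.mdifferentiableAt hxU.2) hξ)
    constructor
    · rw [liftVector_gradient_inner]
      exact (hf.gradient_pos g hxU.2 hξ).ne'
    · intro Z hZ hnull
      have hNx := (hNpos x.2).ne'
      have hZ' := (hf.mem_tangentSpaceOf_univ_prod_iff hx.2 hxU.2).1 hZ
      rw [staticMetric_apply] at hnull
      rw [hessianAt_timeIndependent hg hN hG (hf.contMDiffAt hxU.2),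
        hessianAt_eq_of_isTotallyUmbilic hn hNpos hU hC hf hx.2 hxU.2 hξ hZ' hZ',
        sub_eq_zero.1 hnull]
      field_simp
      ring

/-- Characterization of the non-degenerate photon spheres of a static spacetime. -/
theorem isPhotonSphere_univ_prod_iff (hn : 2 ≤ n) (hN : ContMDiff (𝓡 n) 𝓘(ℝ, ℝ) ∞ N)
    (hNpos : ∀ x, 0 < N x) (hS : IsHypersurface (𝓡 n) S) :
    IsPhotonSphere (metricField g) N ((univ : Set ℝ) ×ˢ S) ↔
      IsTotallyUmbilic (metricField g) S ∧ IsConstOn N S ∧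
        PhotonSphereConstraint (metricField g) N S := by
  constructor
  · rintro ⟨hP, -, hc⟩
    refine ⟨isTotallyUmbilic_of_isPhotonSurface hN hNpos hP hS,
      (isConstOn_univ_prod_iff fun _ => rfl).1 hc, fun x hx ν hν => ?_⟩
    have := (hNpos x).ne'
    rw [meanCurvature_eq_of_isPhotonSurface hN hNpos hP hS hx hν]
    field_simp
  · rintro ⟨hU, hc, hC⟩
    exact ⟨isPhotonSurface_of_isTotallyUmbilic hn hN hNpos hS hU hC, ⟨S, hS, rfl⟩,
      (isConstOn_univ_prod_iff fun _ => rfl).2 hc⟩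

theorem differentialLength_timeIndependent (hN : ContMDiff (𝓡 n) 𝓘(ℝ, ℝ) ∞ N)
    (hNpos : ∀ x, 0 < N x) {Ψ : M → ℝ} (hΨ : ContMDiff (𝓡 n) 𝓘(ℝ, ℝ) ∞ Ψ) (p : ℝ × M) :
    differentialLength (staticMetric (metricField g) N) (timeIndependent Ψ) p =
      differentialLength (metricField g) Ψ p.2 := by
  have hg := isSmoothMetric_metricField g
  have hΨp : MDifferentiableAt (𝓡 n) 𝓘(ℝ, ℝ) Ψ p.2 := (hΨ p.2).mdifferentiableAt (by simp)
  obtain ⟨ξ, hξ⟩ := IsDefiningFunction.exists_isGradient hg Ψ p.2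
  rw [differentialLength_eq (isSmoothMetric_staticMetric hg hN hNpos)
    (IsGradient.timeIndependent hΨp hξ), differentialLength_eq hg hξ,
    mvfderiv_timeIndependent hΨp, spaceComp_liftVector]

end StaticHypersurface

end PhotonSphere

end

/-! ### The constraint and the characterizations. -/

theorem mainTheorem9 {n : ℕ} (hn : 2 ≤ n)
    {M : Type*} [TopologicalSpace M] [T2Space M] [SecondCountableTopology M]
    [ChartedSpace (EuclideanSpace ℝ (Fin n)) M] [IsManifold (𝓡 n) ∞ M]
    (g : ContMDiffRiemannianMetric (𝓡 n) ∞ (EuclideanSpace ℝ (Fin n))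
      (fun x : M => TangentSpace (𝓡 n) x))
    (N : M → ℝ) (hN : ContMDiff (𝓡 n) 𝓘(ℝ, ℝ) ∞ N) (hNpos : ∀ x, 0 < N x) :
    -- the constraint and its consequences, for every non-degenerate photon sphere `P`
    (∀ P : Set (ℝ × M), IsPhotonSphere (metricField g) N P →
      IsNondegenerate n N P →
      -- `N H = (n - 1) ν(N)` on every canonical time slice
      (∀ t : ℝ, PhotonSphereConstraint (metricField g) N (timeSlice P t)) ∧
      -- `ν(N) H > 0` on every canonical time slice
      (∀ t : ℝ, ∀ x ∈ timeSlice P t, ∀ ν : TangentSpace (𝓡 n) x,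
        IsUnitNormal (metricField g) (timeSlice P t) x ν →
        0 < mvfderiv (𝓡 n) N x ν *
          meanCurvature (metricField g) (timeSlice P t) x ν) ∧
      -- `η(N) 𝔥 > 0` along `P`, where `𝔥` is the mean curvature of `P` in the spacetime
      (∀ p ∈ P, ∀ η : TangentSpace (𝓘(ℝ, ℝ).prod (𝓡 n)) p,
        IsUnitNormal (staticMetric (metricField g) N) P p η →
        0 < mvfderiv (𝓘(ℝ, ℝ).prod (𝓡 n)) (timeIndependent N) p η *
          meanCurvature (staticMetric (metricField g) N) P p η) ∧
      -- `H` is constant along any, or every, time slice iff `ν(N)` is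
      (∀ ν : ∀ x : M, TangentSpace (𝓡 n) x,
        (∀ t : ℝ, ∀ x ∈ timeSlice P t,
          IsUnitNormal (metricField g) (timeSlice P t) x (ν x)) →
        ∀ t t' : ℝ,
          IsConstOn
              (fun x => meanCurvature (metricField g) (timeSlice P t) x (ν x))
              (timeSlice P t) ↔
            IsConstOn (fun x => mvfderiv (𝓡 n) N x (ν x)) (timeSlice P t')) ∧
      -- `𝔥` is constant along `P` iff `η(N)` is
      (∀ η : ∀ p : ℝ × M, TangentSpace (𝓘(ℝ, ℝ).prod (𝓡 n)) p,
        (∀ p ∈ P,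
          IsUnitNormal (staticMetric (metricField g) N) P p (η p)) →
        (IsConstOn
            (fun p => meanCurvature (staticMetric (metricField g) N) P p (η p))
            P ↔
          IsConstOn (fun p => mvfderiv (𝓘(ℝ, ℝ).prod (𝓡 n)) (timeIndependent N) p (η p)) P))) ∧
    -- the characterization of non-degenerate photon spheres in static spacetimes
    (∀ S : Set M, IsHypersurface (𝓡 n) S →
      ((IsPhotonSphere (metricField g) N (univ ×ˢ S) ∧
          IsNondegenerate n N (univ ×ˢ S)) ↔
        (IsTotallyUmbilic (metricField g) S ∧ IsConstOn N S ∧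
          (∀ x ∈ S, mvfderiv (𝓡 n) N x ≠ 0) ∧
          PhotonSphereConstraint (metricField g) N S))) ∧
    -- the characterization of non-degenerate photon spheres in electrostatic spacetimes
    (∀ Ψ : M → ℝ, ContMDiff (𝓡 n) 𝓘(ℝ, ℝ) ∞ Ψ →
      ∀ S : Set M, IsHypersurface (𝓡 n) S →
      ((IsElectrostaticPhotonSphere (metricField g) N Ψ (univ ×ˢ S) ∧
          IsNondegenerate n N (univ ×ˢ S)) ↔
        (IsTotallyUmbilic (metricField g) S ∧ IsConstOn N S ∧
          IsConstOn Ψ S ∧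
          IsConstOn (differentialLength (metricField g) Ψ) S ∧
          (∀ x ∈ S, mvfderiv (𝓡 n) N x ≠ 0) ∧
          PhotonSphereConstraint (metricField g) N S))) := by
  refine ⟨?_, fun S hS => ?_, fun Ψ hΨ S hS => ?_⟩
  · intro P hP hnd
    obtain ⟨S, hS, rfl, hNS⟩ := hP.exists_eq_univ_prod
    have hn' : (2 : ℝ) ≤ n := by exact_mod_cast hn
    have hdN := (isNondegenerate_univ_prod_iff hN).1 hnd
    have hH := fun (x : M) (hx : x ∈ S) (ν : TangentSpace (𝓡 n) x) hν =>
      meanCurvature_eq_of_isPhotonSurface hN hNpos hP.1 hS hx (ν := ν) hν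
    have hHH := fun (p : ℝ × M) (hp : p ∈ (univ : Set ℝ) ×ˢ S)
        (η : TangentSpace (𝓘(ℝ, ℝ).prod (𝓡 n)) p) hη =>
      meanCurvature_univ_prod_eq_of_isPhotonSurface hN hNpos hP.1 hS hp.2 (η := η) hη
    simp only [timeSlice_univ_prod]
    refine ⟨fun _ => ((isPhotonSphere_univ_prod_iff hn hN hNpos hS).1 hP).2.2,
      fun _ x hx ν hν => ?_, fun p hp η hη => ?_, fun ν hν _ _ => ?_, fun η hη => ?_⟩
    -- The product is `(n - 1) / N` times the square of `ν(N)`, which is nonzero.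
    · have h0 := mvfderiv_unitNormal_ne_zero hN hS hNS hx (hdN x hx) hν
      rw [hH x hx ν hν, mul_left_comm]
      exact mul_pos (div_pos (by linarith) (hNpos x)) (mul_self_pos.2 h0)
    · have h0 := mvfderiv_timeIndependent_unitNormal_ne_zero hN hNpos hS hNS hp.2
        (hdN p.2 hp.2) hη
      rw [hHH p hp η hη, mul_left_comm]
      exact mul_pos (div_pos (by linarith) (hNpos p.2)) (mul_self_pos.2 h0)
    -- All time slices equal `S`. A point of `S` is needed only to name the constant value of `N` in
    -- the proportionality factor.
    · obtain hemp | ⟨x₀, hx₀⟩ := S.eq_empty_or_nonempty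
      · simp [hemp, IsConstOn]
      · obtain ⟨c, hc⟩ := hNS
        refine isConstOn_iff_of_eq_mul (c := ((n : ℝ) - 1) / N x₀)
          (div_pos (by linarith) (hNpos x₀)).ne' fun x hx => ?_
        rw [hH x hx _ (hν 0 x hx), hc x hx, hc x₀ hx₀]
    · obtain hemp | ⟨p₀, hp₀⟩ := ((univ : Set ℝ) ×ˢ S).eq_empty_or_nonempty
      · simp [hemp, IsConstOn]
      · obtain ⟨c, hc⟩ := hNS
        refine isConstOn_iff_of_eq_mul (c := (n : ℝ) / N p₀.2)
          (div_pos (by linarith) (hNpos p₀.2)).ne' fun p hp => ?_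
        rw [hHH p hp _ (hη p hp), hc p.2 hp.2, hc p₀.2 hp₀.2]
  · rw [isPhotonSphere_univ_prod_iff hn hN hNpos hS, isNondegenerate_univ_prod_iff hN]
    tauto
  · rw [IsElectrostaticPhotonSphere, isPhotonSphere_univ_prod_iff hn hN hNpos hS,
      isNondegenerate_univ_prod_iff hN,
      isConstOn_univ_prod_iff (k := timeIndependent Ψ) (k' := Ψ) fun _ => rfl,
      isConstOn_univ_prod_iff (differentialLength_timeIndependent hN hNpos hΨ)]
    tauto
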